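/- All Banach lattices are real. For a Banach lattice $E$ with closed unit ball $B_E$, a set $A\subseteq E$ is \emph{almost order bounded} if for every $\varepsilon>0$ there is $u\in E^+$ with $A\subseteq[-u,u]+\varepsilon B_E$. A continuous linear operator $T:E\to F$ between Banach lattices is \emph{almost order-weakly compact} ($ao$-$wc$) if $T(A)$ is relatively weakly compact in $F$ for every almost order bounded $A\subseteq E$. A Banach lattice $E$ has \emph{order continuous norm} if every net $x_\alpha\downarrow 0$ in $E$ satisfies $\|x_\alpha\|\to 0$; it has \emph{property (b)} if every subset of $E$ that is order bounded in the bidual $E''$ is order bounded in $E$; it has the \emph{dual positive Schur property} if every positive weak$^*$-null sequence in $E'$ is norm null. The modulus $|T|$ of an operator $T:E\to F$ is the supremum of $T$ and $-T$ in the ordered vector space of linear operators $E\to F$, if that supremum exists. The following statements are true. (1) Let $E$ be a Dedekind complete Banach lattice. Then $E$ has order continuous norm if and only if, for every Banach lattice $F$, each positive operator $T:E\to F$ is $ao$-$wc$. (2) Let $E$ be a Dedekind complete Banach lattice. Then $E$ has order continuous norm if and only if each almost order bounded disjoint sequence $(x_n)$ in $E$ is norm null. (3) Let $E$ be a Banach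 lattice with property (b). If $T^2:E\to E$ is $ao$-$wc$ for every continuous operator $T:E\to E$, then $E$ has order continuous norm. (4) Let $T:E\to F$ be a continuous operator between Banach lattices $E,F$, with $F$ Dedekind complete. If $|T|$ exists and is $ao$-$wc$, then $T$ is $ao$-$wc$. (5) Let $E,F$ be Banach lattices such that $E$ has the dual positive Schur property and $F$ has order continuous norm and is Dedekind complete. Then the adjoint $T':F'\to E'$ of each positive operator $T:E\to F$ is $ao$-$wc$. -/

import Mathlib

open Filter Topology
open scoped Pointwise

universe u v

/-- A real Banach lattice: a complete normed space with a lattice order that is compatible with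
the vector space structure and for which `|x| ≤ |y|` implies `‖x‖ ≤ ‖y‖`. -/
class BanachLattice (E : Type u) [NormedAddCommGroup E] [NormedSpace ℝ E] [Lattice E] : Prop
    extends IsOrderedAddMonoid E, IsOrderedModule ℝ E, HasSolidNorm E, CompleteSpace E

/-- The dual order on the norm dual: `f ≤ g` iff `f x ≤ g x` for all `x ≥ 0`. -/
instance dualPreorder (E : Type u) [NormedAddCommGroup E] [NormedSpace ℝ E] [Preorder E] :
    Preorder (StrongDual ℝ E) where
  le f g := ∀ x : E, 0 ≤ x → f x ≤ g x
  le_refl _ _ _ := le_rfl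
  le_trans _ _ _ hfg hgh x hx := (hfg x hx).trans (hgh x hx)

/-- `A` is almost order bounded: for each `ε > 0` there is `u ≥ 0` with
`A ⊆ [-u, u] + ε B`, where `B` is the closed unit ball. Only the order and the norm enter. -/
def AlmostOrderBounded {E : Type u} [NormedAddCommGroup E] [Preorder E] (A : Set E) : Prop :=
  ∀ ε : ℝ, 0 < ε → ∃ w : E, 0 ≤ w ∧ A ⊆ Set.Icc (-w) w + Metric.closedBall (0 : E) ε

/-- `A` is relatively weakly compact: its closure in the weak topology is weakly compact. -/
def RelativelyWeaklyCompact {X : Type u} [NormedAddCommGroup X] [NormedSpace ℝ X]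
    (A : Set X) : Prop :=
  IsCompact (closure (toWeakSpace ℝ X '' A))

/-- Almost order-weakly compact operators: continuous linear operators that map almost order
bounded sets to relatively weakly compact sets. -/
def IsAOWeaklyCompact {E : Type u} {F : Type v} [NormedAddCommGroup E] [NormedSpace ℝ E]
    [Preorder E] [NormedAddCommGroup F] [NormedSpace ℝ F] (T : E →ₗ[ℝ] F) : Prop :=
  Continuous T ∧ ∀ A : Set E, AlmostOrderBounded A → RelativelyWeaklyCompact (T '' A)

/-- The order of operators: `S ≤ T` iff `S x ≤ T x` for all `x ≥ 0`. -/
def OperatorLE {E : Type u} {F : Type v} [AddCommGroup E] [Module ℝ E] [Preorder E]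
    [AddCommGroup F] [Module ℝ F] [Preorder F] (S T : E →ₗ[ℝ] F) : Prop :=
  ∀ x : E, 0 ≤ x → S x ≤ T x

/-- Positive operators. -/
def IsPositiveOperator {E : Type u} {F : Type v} [AddCommGroup E] [Module ℝ E] [Preorder E]
    [AddCommGroup F] [Module ℝ F] [Preorder F] (T : E →ₗ[ℝ] F) : Prop :=
  ∀ x : E, 0 ≤ x → 0 ≤ T x

/-- `S` is the modulus `|T|`: the supremum of `T` and `-T` in the ordered vector space of all
operators from `E` to `F`. -/
def IsModulus {E : Type u} {F : Type v} [AddCommGroup E] [Module ℝ E] [Preorder E]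
    [AddCommGroup F] [Module ℝ F] [Preorder F] (T S : E →ₗ[ℝ] F) : Prop :=
  OperatorLE T S ∧ OperatorLE (-T) S ∧
    ∀ R : E →ₗ[ℝ] F, OperatorLE T R → OperatorLE (-T) R → OperatorLE S R

/-- Dedekind completeness: each nonempty subset that is bounded above has a supremum. -/
def DedekindComplete (E : Type u) [Preorder E] : Prop :=
  ∀ A : Set E, A.Nonempty → BddAbove A → ∃ a : E, IsLUB A a

/-- Order continuous norm: each decreasing net with infimum `0` is norm null. (The range of such
a net is a downward directed subset of `E`, so index sets in the universe of `E` suffice.) -/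
def HasOrderContinuousNorm (E : Type u) [NormedAddCommGroup E] [Preorder E] : Prop :=
  ∀ (ι : Type u) [Preorder ι] [IsDirectedOrder ι] [Nonempty ι] (x : ι → E),
    Antitone x → IsGLB (Set.range x) 0 → Tendsto (fun i => ‖x i‖) atTop (𝓝 0)

/-- Disjoint sequences: `|x m| ⊓ |x n| = 0` for `m ≠ n`. -/
def DisjointSeq {E : Type u} [AddCommGroup E] [Lattice E] (x : ℕ → E) : Prop :=
  Pairwise fun m n => |x m| ⊓ |x n| = 0

/-- Property (b): each subset of `E` that is order bounded in the bidual (under the canonical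
embedding) is order bounded in `E`. -/
def PropertyB (E : Type u) [NormedAddCommGroup E] [NormedSpace ℝ E] [Preorder E] : Prop :=
  ∀ A : Set E,
    (∃ a b : StrongDual ℝ (StrongDual ℝ E),
      NormedSpace.inclusionInDoubleDual ℝ E '' A ⊆ Set.Icc a b) →
    ∃ a b : E, A ⊆ Set.Icc a b

/-- The dual positive Schur property: each positive weak* null sequence in the dual is norm
null. -/
def DualPositiveSchur (E : Type u) [NormedAddCommGroup E] [NormedSpace ℝ E] [Preorder E] : Prop :=
  ∀ f : ℕ → StrongDual ℝ E, (∀ n, 0 ≤ f n) →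
    Tendsto (fun n => StrongDual.toWeakDual (f n)) atTop (𝓝 0) →
    Tendsto (fun n => ‖f n‖) atTop (𝓝 0)

/-- The adjoint `T' : F' → E'`, `f ↦ f ∘ T`, of a continuous operator. -/
noncomputable def adjointOperator {E : Type u} {F : Type v} [NormedAddCommGroup E]
    [NormedSpace ℝ E] [NormedAddCommGroup F] [NormedSpace ℝ F] (T : E →L[ℝ] F) :
    StrongDual ℝ F →L[ℝ] StrongDual ℝ E :=
  ContinuousLinearMap.precomp ℝ T

/-!
# Almost order-weakly compact operators and order continuous norms

Everything is reduced to one sequential condition on a Banach lattice `E`, `BoundedSeriesNull E`: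
the terms of a series of positive elements with order bounded partial sums are norm null. It says
that order bounded increasing sequences, and then order bounded increasing nets, are norm
convergent, so it is equivalent to order continuity of the norm together with Dedekind
completeness.

* It holds if order intervals are relatively weakly compact: an increasing sequence in a relatively
  weakly compact set is norm convergent (`RelativelyWeaklyCompact.exists_tendsto_of_monotone`).
  Applied to the identity operator this gives the converse half of the first claim and the whole of
  the third one.
* It holds if order bounded disjoint sequences are norm null (`DisjointSeqNull.boundedSeriesNull`).
  If `∑ y n ≤ b`, then at most `1 / δ` of the `y n` can exceed `δ b` at any point, so an induction
  on this multiplicity reduces to asymptotically disjoint sequences, and these can be perturbed to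
  disjoint ones.
* It holds in `E'` if `E` has the dual positive Schur property, as the terms of a bounded series of
  positive functionals are weak* null.

The central result is that order intervals are relatively weakly compact when the norm is order
continuous and the space is Dedekind complete (`relativelyWeaklyCompact_Icc`). A weak* limit point
`φ` of `[0, u]` in the bidual satisfies `0 ≤ φ ≤ u`. A maximal `x` in `[0, u]` with `x ≤ φ` exists
by Zorn's lemma, so it suffices that a nonzero `φ` dominates some `x > 0`
(`exists_pos_le_bidual`). For this, if `φ f > ε f u`, a Hahn decomposition produces `g ≥ 0` with
`φ ≥ ε u` on the functionals below multiples of `g`; if `v` is the part of `u` on which `g` is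
strictly positive, then `h ⊓ n g` increases to `h` at `v` for each `h ≥ 0`, and `x = ε v` works.

Almost order bounded sets are approximated by order intervals, so by Grothendieck's criterion
(`relativelyWeaklyCompact_of_approx`) only order intervals matter for the compactness of operators.
For an operator `T` dominated by an almost order-weakly compact `S = |T|`, the seminorm
`x ↦ ‖S |x|‖` defines a Banach lattice completion `G` of the domain. The space `G` satisfies
`BoundedSeriesNull` because `S` maps bounded increasing sequences to norm convergent ones, and `T`
factors through `G`, whose order intervals are relatively weakly compact
(`IsAOWeaklyCompact.of_dominated`).
-/

/-! ### Order continuity and bounded series -/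

section OrderContinuity

variable {E : Type u} [NormedAddCommGroup E] [NormedSpace ℝ E] [Lattice E] [BanachLattice E]

theorem norm_le_norm_of_nonneg_of_le {x y : E} (hx : 0 ≤ x) (hxy : x ≤ y) : ‖x‖ ≤ ‖y‖ := by
  apply HasSolidNorm.solid
  rwa [abs_of_nonneg hx, abs_of_nonneg (hx.trans hxy)]

/-- The terms of every series of positive elements with order bounded partial sums tend to zero in
norm. For a Banach lattice this sequential condition is equivalent to order continuity of the norm
together with Dedekind completeness. -/
def BoundedSeriesNull (E : Type u) [NormedAddCommGroup E] [Preorder E] : Prop :=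
  ∀ (y : ℕ → E) (b : E), (∀ n, 0 ≤ y n) → (∀ n, ∑ k ∈ Finset.range n, y k ≤ b) →
    Tendsto (fun n => ‖y n‖) atTop (𝓝 0)

/-- Order bounded increasing nets are norm Cauchy: otherwise the increments of a suitable increasing
sequence extracted from the net violate the hypothesis. The limit is the supremum. -/
theorem BoundedSeriesNull.exists_tendsto (hE : BoundedSeriesNull E) {ι : Type*} [Preorder ι]
    [IsDirectedOrder ι] [Nonempty ι] {x : ι → E} (hx : Monotone x) {b : E} (hb : ∀ i, x i ≤ b) :
    ∃ s, IsLUB (Set.range x) s ∧ Tendsto x atTop (𝓝 s) := by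
  have key : ∀ ε > 0, ∃ i, ∀ j, i ≤ j → ‖x j - x i‖ < ε := by
    by_contra! H
    obtain ⟨ε, hε, H⟩ := H
    choose g hg hgε using H
    obtain ⟨i₀⟩ := ‹Nonempty ι›
    let a : ℕ → ι := fun n => g^[n] i₀
    have ha : ∀ n, a (n + 1) = g (a n) := fun n => Function.iterate_succ_apply' g n i₀
    have hlim := hE (fun n => x (a (n + 1)) - x (a n)) (b - x (a 0))
      (fun n => sub_nonneg.2 (hx (by rw [ha]; exact hg _)))
      (fun n => by
        rw [Finset.sum_range_sub (fun n => x (a n))]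
        exact sub_le_sub_right (hb _) _)
    obtain ⟨n, hn⟩ := (hlim.eventually (gt_mem_nhds hε)).exists
    rw [ha] at hn
    exact absurd (hgε (a n)) (not_le.2 hn)
  have hC : Cauchy (map x atTop) := by
    refine Metric.cauchy_iff.2 ⟨inferInstance, fun ε hε => ?_⟩
    obtain ⟨i, hi⟩ := key (ε / 2) (half_pos hε)
    refine ⟨x '' Set.Ici i, image_mem_map (Ici_mem_atTop i), ?_⟩
    rintro _ ⟨j, hj, rfl⟩ _ ⟨k, hk, rfl⟩
    calc dist (x j) (x k) ≤ dist (x j) (x i) + dist (x k) (x i) := dist_triangle_right _ _ _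
      _ < ε / 2 + ε / 2 := by
        rw [dist_eq_norm, dist_eq_norm]; exact add_lt_add (hi j hj) (hi k hk)
      _ = ε := add_halves ε
  obtain ⟨s, hs⟩ := CompleteSpace.complete hC
  have hs' : Tendsto x atTop (𝓝 s) := hs
  refine ⟨s, ⟨?_, fun c hc => le_of_tendsto' hs' fun i => hc ⟨i, rfl⟩⟩, hs'⟩
  rintro _ ⟨i, rfl⟩
  exact ge_of_tendsto hs' (mem_of_superset (Ici_mem_atTop i) fun j hj => hx hj)

theorem BoundedSeriesNull.hasOrderContinuousNorm (hE : BoundedSeriesNull E) :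
    HasOrderContinuousNorm E := by
  intro ι _ _ _ x hx hglb
  obtain ⟨s, hs, hlim⟩ := hE.exists_tendsto (x := fun i => -x i) (b := 0)
    (fun i j hij => neg_le_neg (hx hij)) (fun i => neg_nonpos.2 (hglb.1 ⟨i, rfl⟩))
  have hs0 : s = 0 := by
    refine hs.unique ⟨?_, fun c hc => ?_⟩
    · rintro _ ⟨i, rfl⟩
      exact neg_nonpos.2 (hglb.1 ⟨i, rfl⟩)
    · refine neg_nonpos.1 (hglb.2 ?_)
      rintro _ ⟨i, rfl⟩
      exact neg_le.1 (hc ⟨i, rfl⟩)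
  simpa [hs0] using hlim.norm

/-- The supremum of a set is the limit of the net of its finite suprema. -/
theorem BoundedSeriesNull.dedekindComplete (hE : BoundedSeriesNull E) : DedekindComplete E := by
  intro A hA ⟨b, hb⟩
  have hdir : DirectedOn (· ≤ ·) (supClosure A) := supClosed_supClosure.directedOn
  have : IsDirectedOrder (supClosure A) := directedOn_iff_isDirectedOrder.1 hdir
  have : Nonempty (supClosure A) := (hA.mono subset_supClosure).to_subtype
  have hb' : b ∈ upperBounds (supClosure A) := by rwa [upperBounds_supClosure]
  obtain ⟨s, hs, -⟩ := hE.exists_tendsto (x := fun d : supClosure A => (d : E))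
    (fun _ _ h => h) (fun d => hb' d.2)
  exact ⟨s, by simpa using hs⟩

/-- Order continuity for upward directed sets, which avoids the universe of the index set. -/
theorem HasOrderContinuousNorm.exists_norm_sub_lt (hE : HasOrderContinuousNorm E) {D : Set E}
    (hne : D.Nonempty) (hD : DirectedOn (· ≤ ·) D) {s : E} (hs : IsLUB D s) {ε : ℝ} (hε : 0 < ε) :
    ∃ d ∈ D, ‖s - d‖ < ε := by
  have : IsDirectedOrder D := directedOn_iff_isDirectedOrder.1 hD
  have : Nonempty D := hne.to_subtype
  have hlim := hE D (fun d => s - d) (fun a b hab => sub_le_sub_left (show (a : E) ≤ b from hab) s)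
    (by
      refine ⟨?_, fun c hc => ?_⟩
      · rintro _ ⟨d, rfl⟩
        exact sub_nonneg.2 (hs.1 d.2)
      · have : s ≤ s - c := hs.2 fun d hd => le_sub_comm.1 (hc ⟨⟨d, hd⟩, rfl⟩)
        simpa using this)
  obtain ⟨d, hd⟩ := (hlim.eventually (gt_mem_nhds hε)).exists
  exact ⟨d, d.2, hd⟩

theorem HasOrderContinuousNorm.tendsto_of_monotone (hE : HasOrderContinuousNorm E) {x : ℕ → E}
    (hx : Monotone x) {s : E} (hs : IsLUB (Set.range x) s) : Tendsto x atTop (𝓝 s) := by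
  refine Metric.tendsto_atTop.2 fun ε hε => ?_
  obtain ⟨_, ⟨N, rfl⟩, hN⟩ := hE.exists_norm_sub_lt (Set.range_nonempty x)
    (directedOn_range.2 hx.directed_le) hs hε
  refine ⟨N, fun n hn => ?_⟩
  rw [dist_comm, dist_eq_norm]
  exact (norm_le_norm_of_nonneg_of_le (sub_nonneg.2 (hs.1 ⟨n, rfl⟩))
    (sub_le_sub_left (hx hn) s)).trans_lt hN

theorem HasOrderContinuousNorm.tendsto_of_antitone (hE : HasOrderContinuousNorm E) {x : ℕ → E}
    (hx : Antitone x) {s : E} (hs : IsGLB (Set.range x) s) : Tendsto x atTop (𝓝 s) := by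
  have := hE.tendsto_of_monotone (x := fun n => -x n) (fun m n h => neg_le_neg (hx h)) (s := -s)
    (by
      refine ⟨?_, fun c hc => ?_⟩
      · rintro _ ⟨n, rfl⟩
        exact neg_le_neg (hs.1 ⟨n, rfl⟩)
      · refine neg_le.1 (hs.2 ?_)
        rintro _ ⟨n, rfl⟩
        exact neg_le.1 (hc ⟨n, rfl⟩))
  simpa using this.neg

theorem DedekindComplete.exists_isGLB (hE : DedekindComplete E) {A : Set E} (hA : A.Nonempty)
    (hb : BddBelow A) : ∃ a, IsGLB A a := by
  obtain ⟨a, ha⟩ := hE (-A) hA.neg hb.neg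
  exact ⟨-a, by simpa using ha.neg⟩

theorem HasOrderContinuousNorm.boundedSeriesNull (hE : HasOrderContinuousNorm E)
    (hdc : DedekindComplete E) : BoundedSeriesNull E := by
  intro y b hy hb
  have hmono : Monotone fun n => ∑ k ∈ Finset.range n, y k :=
    monotone_nat_of_le_succ fun n => by
      rw [Finset.sum_range_succ]; exact le_add_of_nonneg_right (hy n)
  obtain ⟨s, hs⟩ := hdc (Set.range fun n => ∑ k ∈ Finset.range n, y k) (Set.range_nonempty _)
    ⟨b, by rintro _ ⟨n, rfl⟩; exact hb n⟩
  have hlim := hE.tendsto_of_monotone hmono hs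
  have := ((tendsto_add_atTop_iff_nat 1).2 hlim).sub hlim
  simpa [Finset.sum_range_succ] using this.norm

end OrderContinuity

/-! ### Relatively weakly compact sets -/

section WeakCompactness

variable {X : Type u} [NormedAddCommGroup X] [NormedSpace ℝ X]

theorem RelativelyWeaklyCompact.mono {A B : Set X} (hB : RelativelyWeaklyCompact B) (h : A ⊆ B) :
    RelativelyWeaklyCompact A :=
  IsCompact.of_isClosed_subset hB isClosed_closure (closure_mono (Set.image_mono h))

theorem RelativelyWeaklyCompact.image {Y : Type v} [NormedAddCommGroup Y] [NormedSpace ℝ Y]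
    {A : Set X} (hA : RelativelyWeaklyCompact A) (T : X →L[ℝ] Y) :
    RelativelyWeaklyCompact (T '' A) := by
  have hc : IsCompact (WeakSpace.map T '' closure (toWeakSpace ℝ X '' A)) :=
    IsCompact.image hA (WeakSpace.map T).continuous
  refine IsCompact.of_isClosed_subset hc isClosed_closure
    (closure_minimal ?_ hc.isClosed)
  rintro _ ⟨_, ⟨a, ha, rfl⟩, rfl⟩
  exact ⟨toWeakSpace ℝ X a, subset_closure ⟨a, ha, rfl⟩, rfl⟩

open NormedSpace in
/-- Grothendieck's approximation criterion: a set that can be approximated uniformly by relatively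
weakly compact sets is relatively weakly compact. -/
theorem relativelyWeaklyCompact_of_approx [CompleteSpace X] {A : Set X}
    (hA : ∀ ε : ℝ, 0 < ε → ∃ K : Set X, Bornology.IsBounded K ∧ RelativelyWeaklyCompact K ∧
      A ⊆ K + Metric.closedBall (0 : X) ε) : RelativelyWeaklyCompact A := by
  have hbdd : Bornology.IsBounded A := by
    obtain ⟨K, hKb, -, hK⟩ := hA 1 one_pos
    exact (hKb.add Metric.isBounded_closedBall).subset hK
  refine isCompact_closure_of_isBounded ℝ X _ ?_ ?_
  · rwa [Set.preimage_image_eq _ (toWeakSpace ℝ X).injective]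
  intro Φ hΦ
  -- `Φ` is within `ε` of the closed subspace `X` of the bidual, for each `ε`.
  have hmem : WeakDual.toStrongDual Φ ∈ closure (Set.range (inclusionInDoubleDualLi ℝ (E := X))) := by
    refine (Metric.mem_closure_iff (α := StrongDual ℝ (StrongDual ℝ X))).2 fun ε hε => ?_
    obtain ⟨K, -, hK, hAK⟩ := hA (ε / 2) (half_pos hε)
    let C : Set (WeakDual ℝ (StrongDual ℝ X)) :=
      inclusionInDoubleDualWeak ℝ X '' closure (toWeakSpace ℝ X '' K)
    let B : Set (WeakDual ℝ (StrongDual ℝ X)) :=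
      WeakDual.toStrongDual ⁻¹' Metric.closedBall (0 : StrongDual ℝ (StrongDual ℝ X)) (ε / 2)
    have hC : IsCompact C := IsCompact.image hK (inclusionInDoubleDualWeak ℝ X).continuous
    have hB : IsCompact B := WeakDual.isCompact_closedBall (𝕜 := ℝ) (E := StrongDual ℝ X) 0 (ε / 2)
    have hsub : closure (inclusionInDoubleDualWeak ℝ X '' (toWeakSpace ℝ X '' A)) ⊆ C + B := by
      refine closure_minimal ?_ (hC.add hB).isClosed
      rintro _ ⟨_, ⟨a, ha, rfl⟩, rfl⟩
      obtain ⟨k, hk, z, hz, rfl⟩ := hAK ha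
      refine ⟨inclusionInDoubleDualWeak ℝ X (toWeakSpace ℝ X k),
        ⟨_, subset_closure ⟨k, hk, rfl⟩, rfl⟩,
        inclusionInDoubleDualWeak ℝ X (toWeakSpace ℝ X z), ?_, ?_⟩
      · have : ‖inclusionInDoubleDualLi ℝ (E := X) z‖ ≤ ε / 2 := by
          rw [LinearIsometry.norm_map]; simpa using hz
        exact (mem_closedBall_zero_iff (E := StrongDual ℝ (StrongDual ℝ X))).2 this
      · simp only [map_add]
    obtain ⟨_, ⟨x, -, rfl⟩, z, hz, hsum⟩ := hsub hΦ
    refine ⟨inclusionInDoubleDualLi ℝ (E := X) ((toWeakSpace ℝ X).symm x), ⟨_, rfl⟩, ?_⟩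
    have hz' : ‖WeakDual.toStrongDual z‖ ≤ ε / 2 := 
      (mem_closedBall_zero_iff (E := StrongDual ℝ (StrongDual ℝ X))).1 hz
    have : WeakDual.toStrongDual Φ - inclusionInDoubleDualLi ℝ (E := X) ((toWeakSpace ℝ X).symm x)
        = WeakDual.toStrongDual z := by
      rw [← hsum]
      exact add_sub_cancel_left _ _
    refine (dist_eq_norm (E := StrongDual ℝ (StrongDual ℝ X)) _ _).trans_lt ?_
    rw [this]
    linarith
  have hcl : IsClosed (Set.range (inclusionInDoubleDualLi ℝ (E := X))) :=
    ((inclusionInDoubleDualLi ℝ (E := X)).isometry.isUniformInducing.isComplete_range).isClosed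
  obtain ⟨x, hx⟩ := hcl.closure_subset hmem
  exact ⟨toWeakSpace ℝ X x, hx⟩

end WeakCompactness

/-! ### Increasing sequences in weakly compact sets -/

section MonotoneSequences

variable {E : Type u} [NormedAddCommGroup E] [NormedSpace ℝ E] [Lattice E] [BanachLattice E]

/-- A Dini type theorem: an increasing sequence in a relatively weakly compact set converges in
norm. -/
theorem RelativelyWeaklyCompact.exists_tendsto_of_monotone {A : Set E}
    (hA : RelativelyWeaklyCompact A) {x : ℕ → E} (hx : Monotone x) (hxA : ∀ n, x n ∈ A) :
    ∃ s, Tendsto x atTop (𝓝 s) := by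
  obtain ⟨s', -, hs'⟩ := hA.exists_mapClusterPt (f := atTop (α := ℕ))
    (u := fun n => toWeakSpace ℝ E (x n))
    (tendsto_principal.2 (Eventually.of_forall fun n => subset_closure ⟨x n, hxA n, rfl⟩))
  obtain ⟨s, rfl⟩ := (toWeakSpace ℝ E).surjective s'
  have hmem : ∀ C : Set E, Convex ℝ C → ∀ N, (∀ n, N ≤ n → x n ∈ C) → s ∈ closure C := by
    intro C hC N hN
    have h1 : toWeakSpace ℝ E s ∈ closure (toWeakSpace ℝ E '' C) :=
      mem_closure_iff_clusterPt.2 (hs'.clusterPt.mono (le_principal_iff.2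
        (mem_map.2 (mem_of_superset (Ici_mem_atTop N) fun n hn => ⟨x n, hN n hn, rfl⟩))))
    rw [← hC.toWeakSpace_closure ℝ] at h1
    obtain ⟨t, ht, hts⟩ := h1
    exact (toWeakSpace ℝ E).injective hts ▸ ht
  have hle : ∀ n, x n ≤ s := fun n => by
    have := hmem (Set.Ici (x n)) (convex_Ici _) n fun m hm => hx hm
    rwa [isClosed_Ici.closure_eq] at this
  -- The elements below some `x n` form a convex set, so `s` is also a norm limit of such elements.
  have hs : s ∈ closure {z | ∃ n, z ≤ x n} := by
    refine hmem _ ?_ 0 fun n _ => ⟨n, le_rfl⟩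
    rintro z ⟨m, hm⟩ w ⟨n, hn⟩ a b ha hb hab
    refine ⟨max m n, ?_⟩
    calc a • z + b • w ≤ a • x (max m n) + b • x (max m n) :=
          add_le_add (smul_le_smul_of_nonneg_left (hm.trans (hx (le_max_left _ _))) ha)
            (smul_le_smul_of_nonneg_left (hn.trans (hx (le_max_right _ _))) hb)
      _ = x (max m n) := by rw [← add_smul, hab, one_smul]
  refine ⟨s, Metric.tendsto_atTop.2 fun ε hε => ?_⟩
  obtain ⟨z, ⟨N, hN⟩, hz⟩ := Metric.mem_closure_iff.1 hs ε hε
  refine ⟨N, fun n hn => ?_⟩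
  rw [dist_comm]
  rw [dist_eq_norm] at hz ⊢
  exact (norm_le_norm_of_nonneg_of_le (sub_nonneg.2 (hle n))
    (sub_le_sub_left (hN.trans (hx hn)) s)).trans_lt hz

/-- The partial sums of a bounded series increase in a weakly compact order interval, so they
converge in norm. -/
theorem boundedSeriesNull_of_relativelyWeaklyCompact_Icc
    (h : ∀ w : E, 0 ≤ w → RelativelyWeaklyCompact (Set.Icc (-w) w)) : BoundedSeriesNull E := by
  intro y b hy hb
  have hmono : Monotone fun n => ∑ k ∈ Finset.range n, y k :=
    monotone_nat_of_le_succ fun n => by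
      rw [Finset.sum_range_succ]; exact le_add_of_nonneg_right (hy n)
  have hb0 : 0 ≤ b := by simpa using hb 0
  obtain ⟨s, hlim⟩ := (h b hb0).exists_tendsto_of_monotone hmono fun n =>
    ⟨(neg_nonpos.2 hb0).trans (Finset.sum_nonneg fun k _ => hy k), hb n⟩
  have := ((tendsto_add_atTop_iff_nat 1).2 hlim).sub hlim
  simpa [Finset.sum_range_succ] using this.norm

theorem almostOrderBounded_Icc {E : Type u} [NormedAddCommGroup E] [Preorder E] (w : E) (hw : 0 ≤ w) : AlmostOrderBounded (Set.Icc (-w) w) := by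
  intro ε hε
  exact ⟨w, hw, fun x hx => ⟨x, hx, 0, by simp [hε.le], add_zero x⟩⟩

theorem isBounded_Icc_neg (w : E) : Bornology.IsBounded (Set.Icc (-w) w) := by
  refine (Metric.isBounded_closedBall (x := (0 : E)) (r := ‖w‖)).subset fun x hx => ?_
  rw [mem_closedBall_zero_iff]
  exact HasSolidNorm.solid ((abs_le'.2 ⟨hx.2, neg_le.1 hx.1⟩).trans (le_abs_self w))

end MonotoneSequences

/-! ### The dual Banach lattice -/

section DualLattice

variable {E : Type u} [NormedAddCommGroup E] [NormedSpace ℝ E] [Lattice E] [BanachLattice E]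

/-- An additive function on the positive cone which is bounded by a multiple of the norm extends to
a continuous linear functional. -/
theorem exists_strongDual_of_additive {m : E → ℝ} {C : ℝ}
    (hadd : ∀ x y, 0 ≤ x → 0 ≤ y → m (x + y) = m x + m y) (hC : ∀ x, 0 ≤ x → |m x| ≤ C * ‖x‖) :
    ∃ p : StrongDual ℝ E, ∀ x, 0 ≤ x → p x = m x := by
  have hm0 : m 0 = 0 := by simpa using hadd 0 0 le_rfl le_rfl
  have hadd' : ∀ x y : E, m (x + y)⁺ - m (x + y)⁻ = (m x⁺ - m x⁻) + (m y⁺ - m y⁻) := by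
    intro x y
    have h : (x + y)⁺ + (x⁻ + y⁻) = (x + y)⁻ + (x⁺ + y⁺) := by
      have h1 := posPart_sub_negPart (x + y)
      have h2 := posPart_sub_negPart x
      have h3 := posPart_sub_negPart y
      rw [← sub_eq_zero]
      calc (x + y)⁺ + (x⁻ + y⁻) - ((x + y)⁻ + (x⁺ + y⁺))
          = ((x + y)⁺ - (x + y)⁻) - (x⁺ - x⁻) - (y⁺ - y⁻) := by abel
        _ = 0 := by rw [h1, h2, h3]; abel
    have h' := congrArg m h
    rw [hadd _ _ (posPart_nonneg _) (add_nonneg (negPart_nonneg _) (negPart_nonneg _)),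
      hadd _ _ (negPart_nonneg _) (negPart_nonneg _),
      hadd _ _ (negPart_nonneg _) (add_nonneg (posPart_nonneg _) (posPart_nonneg _)),
      hadd _ _ (posPart_nonneg _) (posPart_nonneg _)] at h'
    linarith
  let p₀ : E →+ ℝ := AddMonoidHom.mk' (fun x => m x⁺ - m x⁻) hadd'
  have hcont : Continuous p₀ := by
    refine AddMonoidHomClass.continuous_of_bound p₀ (2 * |C|) fun x => ?_
    have key : ∀ z : E, 0 ≤ z → ‖z‖ ≤ ‖x‖ → |m z| ≤ |C| * ‖x‖ := fun z hz hzx =>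
      (hC z hz).trans (mul_le_mul (le_abs_self C) hzx (norm_nonneg _) (abs_nonneg _))
    have h1 := key x⁺ (posPart_nonneg x) (HasSolidNorm.solid (by
      rw [abs_of_nonneg (posPart_nonneg x), ← posPart_add_negPart x]
      exact le_add_of_nonneg_right (negPart_nonneg x)))
    have h2 := key x⁻ (negPart_nonneg x) (HasSolidNorm.solid (by
      rw [abs_of_nonneg (negPart_nonneg x), ← posPart_add_negPart x]
      exact le_add_of_nonneg_left (posPart_nonneg x)))
    change |m x⁺ - m x⁻| ≤ _
    linarith [abs_sub (m x⁺) (m x⁻)]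
  refine ⟨p₀.toRealLinearMap hcont, fun x hx => ?_⟩
  change m x⁺ - m x⁻ = m x
  rw [posPart_of_nonneg hx, negPart_of_nonneg hx, hm0, sub_zero]

theorem bddAbove_image_Icc (f : StrongDual ℝ E) (x : E) : BddAbove (f '' Set.Icc 0 x) := by
  refine ⟨‖f‖ * ‖x‖, ?_⟩
  rintro _ ⟨y, hy, rfl⟩
  calc f y ≤ ‖f y‖ := Real.le_norm_self _
    _ ≤ ‖f‖ * ‖y‖ := f.le_opNorm y
    _ ≤ ‖f‖ * ‖x‖ :=
      mul_le_mul_of_nonneg_left (norm_le_norm_of_nonneg_of_le hy.1 hy.2) (norm_nonneg _)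

/-- The Riesz decomposition property: `[0, x + y] = [0, x] + [0, y]`. -/
theorem Icc_zero_add {x y : E} (hx : 0 ≤ x) (hy : 0 ≤ y) :
    Set.Icc 0 (x + y) = Set.Icc 0 x + Set.Icc 0 y := by
  refine Set.Subset.antisymm (fun z hz => ?_) ?_
  · refine ⟨z ⊓ x, ⟨le_inf hz.1 hx, inf_le_right⟩, z - z ⊓ x, ⟨sub_nonneg.2 inf_le_left, ?_⟩,
      add_sub_cancel _ _⟩
    rw [sub_inf, sub_self]
    exact sup_le hy (sub_le_iff_le_add'.2 hz.2)
  · rintro _ ⟨a, ha, b, hb, rfl⟩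
    exact ⟨add_nonneg ha.1 hb.1, add_le_add ha.2 hb.2⟩

/-- The Riesz–Kantorovich formula: each functional `f` on a Banach lattice has a positive part,
given on the positive cone by `x ↦ sup f [0, x]`. -/
theorem exists_dualPosPart (f : StrongDual ℝ E) :
    ∃ p : StrongDual ℝ E, ∀ x, 0 ≤ x → IsLUB (f '' Set.Icc 0 x) (p x) := by
  have hlub : ∀ x : E, 0 ≤ x → IsLUB (f '' Set.Icc 0 x) (sSup (f '' Set.Icc 0 x)) := fun x hx =>
    isLUB_csSup ⟨f 0, 0, ⟨le_rfl, hx⟩, rfl⟩ (bddAbove_image_Icc f x)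
  obtain ⟨p, hp⟩ := exists_strongDual_of_additive (E := E)
    (m := fun x => sSup (f '' Set.Icc 0 x)) (C := ‖f‖) (fun x y hx hy => by
      refine (hlub _ (add_nonneg hx hy)).unique ?_
      rw [Icc_zero_add hx hy, Set.image_add]
      exact (hlub x hx).add (hlub y hy)) (fun x hx => by
      have h0 : 0 ≤ sSup (f '' Set.Icc 0 x) := (hlub x hx).1 ⟨0, ⟨le_rfl, hx⟩, map_zero f⟩
      rw [abs_of_nonneg h0]
      refine (hlub x hx).2 ?_
      rintro _ ⟨y, hy, rfl⟩
      calc f y ≤ ‖f y‖ := Real.le_norm_self _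
        _ ≤ ‖f‖ * ‖y‖ := f.le_opNorm y
        _ ≤ ‖f‖ * ‖x‖ :=
          mul_le_mul_of_nonneg_left (norm_le_norm_of_nonneg_of_le hy.1 hy.2) (norm_nonneg _))
  exact ⟨p, fun x hx => by rw [hp x hx]; exact hlub x hx⟩

/-- The positive part of a continuous linear functional in the dual Banach lattice. -/
noncomputable def dualPosPart (f : StrongDual ℝ E) : StrongDual ℝ E :=
  (exists_dualPosPart f).choose

theorem isLUB_dualPosPart (f : StrongDual ℝ E) {x : E} (hx : 0 ≤ x) :
    IsLUB (f '' Set.Icc 0 x) (dualPosPart f x) :=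
  (exists_dualPosPart f).choose_spec x hx

theorem apply_le_dualPosPart (f : StrongDual ℝ E) {x y : E} (hy : 0 ≤ y) (hyx : y ≤ x) :
    f y ≤ dualPosPart f x :=
  (isLUB_dualPosPart f (hy.trans hyx)).1 ⟨y, ⟨hy, hyx⟩, rfl⟩

theorem dualPosPart_apply_nonneg (f : StrongDual ℝ E) {x : E} (hx : 0 ≤ x) :
    0 ≤ dualPosPart f x := by
  simpa using apply_le_dualPosPart f le_rfl hx

theorem apply_mono_of_nonneg {f : StrongDual ℝ E} (hf : 0 ≤ f) {x y : E} (h : x ≤ y) :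
    f x ≤ f y := by
  simpa using hf (y - x) (sub_nonneg.2 h)

/-- The dual of a Banach lattice as a lattice, for the order `dualPreorder`. -/
noncomputable abbrev dualLattice (E : Type u) [NormedAddCommGroup E] [NormedSpace ℝ E] [Lattice E]
    [BanachLattice E] : Lattice (StrongDual ℝ E) :=
  have le_sup_left' : ∀ f g : StrongDual ℝ E, f ≤ g + dualPosPart (f - g) := fun f g x hx => by
    have := apply_le_dualPosPart (f - g) hx le_rfl
    rw [sub_apply] at this
    rw [add_apply]
    linarith
  have le_sup_right' : ∀ f g : StrongDual ℝ E, g ≤ g + dualPosPart (f - g) := fun f g x hx => by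
    have := dualPosPart_apply_nonneg (f - g) hx
    rw [add_apply]
    linarith
  have sup_le' : ∀ f g h : StrongDual ℝ E, f ≤ h → g ≤ h → g + dualPosPart (f - g) ≤ h := by
    intro f g h hf hg x hx
    have hgh : 0 ≤ h - g := fun z hz => by
      rw [sub_apply]; exact sub_nonneg.2 (hg z hz)
    have : dualPosPart (f - g) x ≤ (h - g) x := by
      refine (isLUB_dualPosPart (f - g) hx).2 ?_
      rintro _ ⟨y, hy, rfl⟩
      refine le_trans ?_ (apply_mono_of_nonneg hgh hy.2)
      rw [sub_apply, sub_apply]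
      exact sub_le_sub_right (hf y hy.1) _
    rw [sub_apply] at this
    rw [add_apply]
    linarith
  have neg_le' : ∀ f g : StrongDual ℝ E, f ≤ g → -g ≤ -f := fun f g h x hx => by
    rw [neg_apply, neg_apply]
    exact neg_le_neg (h x hx)
  { dualPreorder E with
    le_antisymm := fun f g hfg hgf => by
      ext x
      have h : ∀ z : E, 0 ≤ z → f z = g z := fun z hz => le_antisymm (hfg z hz) (hgf z hz)
      rw [← posPart_sub_negPart x, map_sub, map_sub, h _ (posPart_nonneg x),
        h _ (negPart_nonneg x)]
    sup := fun f g => g + dualPosPart (f - g)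
    le_sup_left := le_sup_left'
    le_sup_right := le_sup_right'
    sup_le := sup_le'
    inf := fun f g => -(-g + dualPosPart (-f - -g))
    inf_le_left := fun f g => by simpa using neg_le' _ _ (le_sup_left' (-f) (-g))
    inf_le_right := fun f g => by simpa using neg_le' _ _ (le_sup_right' (-f) (-g))
    le_inf := fun f g h hf hg => by
      simpa using neg_le' _ _ (sup_le' (-g) (-h) (-f) (neg_le' _ _ hf) (neg_le' _ _ hg)) }

attribute [local instance] dualLattice

/-- The lattice `dualLattice` is a Banach lattice for the operator norm. Solidity rests on
`|f x| ≤ |f| |x| ≤ ‖f‖ ‖x‖`. -/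
theorem dualBanachLattice : BanachLattice (StrongDual ℝ E) := by
  have hadd : IsOrderedAddMonoid (StrongDual ℝ E) :=
    { add_le_add_left := fun f g hfg h x hx => add_le_add_left (hfg x hx) (h x) }
  have habs : ∀ (f : StrongDual ℝ E) (x : E), |f x| ≤ |f| |x| := by
    intro f x
    have h1 : ∀ z : E, 0 ≤ z → |f z| ≤ |f| z := fun z hz =>
      abs_le'.2 ⟨le_abs_self f z hz, by
        simpa using (neg_le_abs f : -f ≤ |f|) z hz⟩
    calc |f x| = |f x⁺ - f x⁻| := by rw [← map_sub, posPart_sub_negPart]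
      _ ≤ |f x⁺| + |f x⁻| := abs_sub _ _
      _ ≤ |f| x⁺ + |f| x⁻ := add_le_add (h1 _ (posPart_nonneg x)) (h1 _ (negPart_nonneg x))
      _ = |f| |x| := by rw [← map_add, posPart_add_negPart]
  have hle : ∀ (f : StrongDual ℝ E) (x : E), 0 ≤ x → |f| x ≤ ‖f‖ * ‖x‖ := by
    intro f x hx
    change (-f + dualPosPart (f - -f)) x ≤ _
    rw [add_apply, ← le_sub_iff_add_le']
    refine (isLUB_dualPosPart (f - -f) hx).2 ?_
    rintro _ ⟨y, hy, rfl⟩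
    have h2 : |y + y - x| ≤ |x| := by
      rw [abs_of_nonneg hx]
      refine abs_le'.2 ⟨sub_le_iff_le_add.2 (add_le_add hy.2 hy.2), ?_⟩
      rw [neg_sub]
      exact sub_le_self _ (add_nonneg hy.1 hy.1)
    have h3 : f (y + y - x) ≤ ‖f‖ * ‖x‖ := (Real.le_norm_self _).trans ((f.le_opNorm _).trans
      (mul_le_mul_of_nonneg_left (HasSolidNorm.solid h2) (norm_nonneg _)))
    simp only [map_sub, map_add, sub_apply,
      neg_apply] at h3 ⊢
    linarith
  exact
    { toIsOrderedAddMonoid := hadd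
      smul_le_smul_of_nonneg_left := fun c hc f g hfg x hx =>
        mul_le_mul_of_nonneg_left (hfg x hx) hc
      smul_le_smul_of_nonneg_right := fun f hf c d hcd x hx =>
        mul_le_mul_of_nonneg_right hcd (hf x hx)
      solid := fun f g hfg => ContinuousLinearMap.opNorm_le_bound _ (norm_nonneg _) fun x => by
        calc ‖f x‖ ≤ |f| |x| := habs f x
          _ ≤ |g| |x| := hfg _ (abs_nonneg x)
          _ ≤ ‖g‖ * ‖|x|‖ := hle g _ (abs_nonneg x)
          _ = ‖g‖ * ‖x‖ := by rw [norm_abs_eq_norm]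
      toCompleteSpace := inferInstance }

/-- A directed set of positive functionals that is bounded above by `f` has a supremum, which is the
pointwise supremum on the positive cone. -/
theorem exists_isLUB_of_directedOn {D : Set (StrongDual ℝ E)} (hne : D.Nonempty)
    (hD : DirectedOn (· ≤ ·) D) (h0 : ∀ k ∈ D, 0 ≤ k) {f : StrongDual ℝ E}
    (hf : ∀ k ∈ D, k ≤ f) :
    ∃ h : StrongDual ℝ E, ∀ x, 0 ≤ x →
      IsLUB (Set.range fun k : D => (k : StrongDual ℝ E) x) (h x) := by
  have : IsDirectedOrder D := directedOn_iff_isDirectedOrder.1 hD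
  have : Nonempty D := hne.to_subtype
  have hlub : ∀ x, 0 ≤ x → IsLUB (Set.range fun k : D => (k : StrongDual ℝ E) x)
      (⨆ k : D, (k : StrongDual ℝ E) x) := fun x hx =>
    isLUB_ciSup ⟨f x, by rintro _ ⟨k, rfl⟩; exact hf k k.2 x hx⟩
  have hlim : ∀ x, 0 ≤ x → Tendsto (fun k : D => (k : StrongDual ℝ E) x) atTop
      (𝓝 (⨆ k : D, (k : StrongDual ℝ E) x)) := fun x hx =>
    tendsto_atTop_isLUB (fun k l (hkl : (k : StrongDual ℝ E) ≤ l) => hkl x hx) (hlub x hx)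
  obtain ⟨h, hh⟩ := exists_strongDual_of_additive (E := E)
    (m := fun x => ⨆ k : D, (k : StrongDual ℝ E) x) (C := ‖f‖) (fun x y hx hy => by
      refine tendsto_nhds_unique (hlim _ (add_nonneg hx hy)) ?_
      simpa using (hlim x hx).add (hlim y hy)) (fun x hx => by
      have hk : ∀ k : D, |(k : StrongDual ℝ E) x| ≤ ‖f‖ * ‖x‖ := fun k => by
        rw [abs_of_nonneg (h0 k k.2 x hx)]
        exact (hf k k.2 x hx).trans ((Real.le_norm_self _).trans (f.le_opNorm x))
      exact le_of_tendsto' (hlim x hx).abs hk)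
  exact ⟨h, fun x hx => by rw [hh x hx]; exact hlub x hx⟩

end DualLattice

/-! ### Weak compactness of order intervals -/

section OrderIntervals

variable {E : Type u} [NormedAddCommGroup E] [NormedSpace ℝ E] [Lattice E] [BanachLattice E]

/-- Finite suprema of positive elements are dominated by sums. -/
theorem partialSups_le_sum {b : ℕ → E} (hb : ∀ n, 0 ≤ b n) (n : ℕ) :
    partialSups b n ≤ ∑ k ∈ Finset.range (n + 1), b k :=
  partialSups_le _ _ _ fun _ hk =>
    Finset.single_le_sum (fun i _ => hb i) (Finset.mem_range.2 (Nat.lt_succ_of_le hk))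

/-- If `g ≥ 0` is strictly positive on `[0, v]`, then sequences in `[0, v]` along which `g` tends
to zero geometrically tend to zero in norm. -/
theorem tendsto_norm_of_strictlyPositive (hE : HasOrderContinuousNorm E)
    (hdc : DedekindComplete E) {g : StrongDual ℝ E} (hg : 0 ≤ g) {v : E}
    (hgv : ∀ z, 0 ≤ z → z ≤ v → g z = 0 → z = 0) {b : ℕ → E} (hb0 : ∀ n, 0 ≤ b n)
    (hbv : ∀ n, b n ≤ v) {C : ℝ} (hC : ∀ n, g (b n) ≤ C * (1 / 2) ^ n) :
    Tendsto (fun n => ‖b n‖) atTop (𝓝 0) := by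
  have hex : ∀ n, ∃ s, IsLUB (Set.range fun k => b (n + k)) s := fun n =>
    hdc _ (Set.range_nonempty _) ⟨v, by rintro _ ⟨k, rfl⟩; exact hbv _⟩
  choose s hs using hex
  have hbs : ∀ n, b n ≤ s n := fun n => (hs n).1 ⟨0, rfl⟩
  have hanti : Antitone s := antitone_nat_of_succ_le fun n => (hs (n + 1)).2 (by
    rintro _ ⟨k, rfl⟩
    refine (hs n).1 ⟨k + 1, ?_⟩
    change b _ = b _
    congr 1; omega)
  have hs0 : ∀ n, 0 ≤ s n := fun n => (hb0 n).trans (hbs n)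
  -- By order continuity, `g (s n)` is at most the sum of the `g (b k)` with `n ≤ k`.
  have hgs : ∀ n, g (s n) ≤ 2 * C * (1 / 2) ^ n := by
    intro n
    have hlub : IsLUB (Set.range (partialSups fun k => b (n + k))) (s n) := by
      have := hs n
      rwa [IsLUB, ← upperBounds_range_partialSups] at this
    have hlim := (g.continuous.tendsto _).comp (hE.tendsto_of_monotone (partialSups _).monotone hlub)
    refine le_of_tendsto' hlim fun m => ?_
    have hC0 : 0 ≤ C := by
      have := (hg _ (hb0 0)).trans (hC 0)
      simpa using this
    calc g (partialSups (fun k => b (n + k)) m)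
        ≤ g (∑ k ∈ Finset.range (m + 1), b (n + k)) :=
          apply_mono_of_nonneg hg (partialSups_le_sum (fun k => hb0 _) m)
      _ = ∑ k ∈ Finset.range (m + 1), g (b (n + k)) := map_sum _ _ _
      _ ≤ ∑ k ∈ Finset.range (m + 1), C * (1 / 2) ^ n * (1 / 2) ^ k :=
          Finset.sum_le_sum fun k _ => (hC _).trans_eq (by rw [pow_add, mul_assoc])
      _ = C * (1 / 2) ^ n * ∑ k ∈ Finset.range (m + 1), (1 / 2 : ℝ) ^ k := by
          rw [Finset.mul_sum]
      _ ≤ C * (1 / 2) ^ n * 2 :=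
          mul_le_mul_of_nonneg_left (sum_geometric_two_le _) (by positivity)
      _ = 2 * C * (1 / 2) ^ n := by ring
  obtain ⟨t, ht⟩ := hdc.exists_isGLB (Set.range_nonempty s)
    ⟨0, by rintro _ ⟨n, rfl⟩; exact hs0 n⟩
  have ht0 : 0 ≤ t := ht.2 (by rintro _ ⟨n, rfl⟩; exact hs0 n)
  have hgt : g t = 0 := by
    refine le_antisymm ?_ (hg t ht0)
    have hlim : Tendsto (fun n : ℕ => 2 * C * (1 / 2 : ℝ) ^ n) atTop (𝓝 (2 * C * 0)) :=
      (tendsto_pow_atTop_nhds_zero_of_lt_one (by norm_num) (by norm_num)).const_mul _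
    rw [mul_zero] at hlim
    exact ge_of_tendsto' hlim fun n => (apply_mono_of_nonneg hg (ht.1 ⟨n, rfl⟩)).trans (hgs n)
  have htv : t ≤ v := (ht.1 ⟨0, rfl⟩).trans ((hs 0).2 (by rintro _ ⟨k, rfl⟩; exact hbv _))
  have hlim := (hE.tendsto_of_antitone hanti ht).norm
  rw [hgv t ht0 htv hgt, norm_zero] at hlim
  exact squeeze_zero (fun n => norm_nonneg _)
    (fun n => norm_le_norm_of_nonneg_of_le (hb0 n) (hbs n)) hlim

/-- Zorn's lemma for norm closed subsets of order intervals in the presence of order continuity. -/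
theorem exists_maximal_of_isClosed (hE : HasOrderContinuousNorm E) (hdc : DedekindComplete E)
    {S : Set E} (hS : IsClosed S) {u : E} (hu : ∀ z ∈ S, z ≤ u) (hne : S.Nonempty) :
    ∃ w, Maximal (· ∈ S) w := by
  obtain ⟨w₀, hw₀⟩ := hne
  obtain ⟨w, -, hw⟩ := zorn_le_nonempty₀ S (fun c hcS hc y hy => by
    obtain ⟨s, hs⟩ := hdc c ⟨y, hy⟩ ⟨u, fun z hz => hu z (hcS hz)⟩
    refine ⟨s, ?_, hs.1⟩
    refine hS.closure_subset_iff.2 hcS (Metric.mem_closure_iff.2 fun ε hε => ?_)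
    obtain ⟨d, hd, hdε⟩ := hE.exists_norm_sub_lt ⟨y, hy⟩ hc.directedOn hs hε
    exact ⟨d, hd, by rwa [dist_eq_norm]⟩) w₀ hw₀
  exact ⟨w, hw⟩

/-- The part of `u` outside the null ideal of a positive functional `g`: it has the same value
under `g`, and `g` is strictly positive below it. -/
theorem exists_strictlyPositive (hE : HasOrderContinuousNorm E) (hdc : DedekindComplete E)
    {g : StrongDual ℝ E} {u : E} (hu : 0 ≤ u) :
    ∃ v, 0 ≤ v ∧ v ≤ u ∧ g v = g u ∧ ∀ z, 0 ≤ z → z ≤ v → g z = 0 → z = 0 := by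
  obtain ⟨w, hw⟩ := exists_maximal_of_isClosed hE hdc (S := Set.Icc 0 u ∩ g ⁻¹' {0}) (u := u)
    (isClosed_Icc.inter (isClosed_singleton.preimage g.continuous)) (fun z hz => hz.1.2)
    ⟨0, ⟨le_rfl, hu⟩, map_zero g⟩
  obtain ⟨⟨hw0, hwu⟩, hgw : g w = 0⟩ := hw.prop
  refine ⟨u - w, sub_nonneg.2 hwu, sub_le_self _ hw0, by rw [map_sub, hgw, sub_zero],
    fun z hz0 hz hgz => ?_⟩
  have h1 : w ≤ w + z := le_add_of_nonneg_right hz0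
  have h2 : w + z ≤ w := hw.le_of_ge ⟨⟨hw0.trans h1, by
    rw [add_comm]; exact le_sub_iff_add_le.1 hz⟩, by simp [hgw, hgz]⟩ h1
  exact le_antisymm (by simpa using h2) hz0

/-- Hahn decomposition by exhaustion: a functional `φ` on the dual with `φ ≤ u` that exceeds
`ε u` at `f ≥ 0` dominates `ε u` on some interval `[0, g]` with `φ g > ε g u`. -/
theorem exists_hahn {u : E} (hu : 0 ≤ u) {φ : StrongDual ℝ (StrongDual ℝ E)}
    (hφu : ∀ f : StrongDual ℝ E, 0 ≤ f → φ f ≤ f u) {f : StrongDual ℝ E} (hf : 0 ≤ f) {ε : ℝ}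
    (hε : ε * f u < φ f) :
    ∃ g : StrongDual ℝ E, 0 ≤ g ∧ ε * g u < φ g ∧
      ∀ h : StrongDual ℝ E, 0 ≤ h → h ≤ g → ε * h u ≤ φ h := by
  let Q : Set (StrongDual ℝ E) := {h | 0 ≤ h ∧ h ≤ f ∧ φ h ≤ ε * h u}
  have h0 : (0 : StrongDual ℝ E) ∈ Q := ⟨le_rfl, hf, by simp⟩
  obtain ⟨h, -, hh⟩ := zorn_le_nonempty₀ Q (fun c hcQ hc k₀ hk₀ => by
    obtain ⟨h, hh⟩ := exists_isLUB_of_directedOn ⟨k₀, hk₀⟩ hc.directedOn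
      (fun k hk => (hcQ hk).1) (fun k hk => (hcQ hk).2.1)
    have hle : ∀ k ∈ c, k ≤ h := fun k hk x hx => (hh x hx).1 ⟨⟨k, hk⟩, rfl⟩
    refine ⟨h, ⟨(hcQ hk₀).1.trans (hle _ hk₀), fun x hx => (hh x hx).2 ?_, ?_⟩, hle⟩
    · rintro _ ⟨k, rfl⟩
      exact (hcQ k.2).2.1 x hx
    refine le_of_forall_pos_le_add fun δ hδ => ?_
    -- `φ` is order continuous, since `φ (h - k) ≤ (h - k) u`.
    have hδ' : 0 < δ / (1 + |ε|) := div_pos hδ (by positivity)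
    obtain ⟨_, ⟨⟨k, hk⟩, rfl⟩, hkδ, -⟩ := (hh u hu).exists_between (sub_lt_self (h u) hδ')
    have h1 : φ (h - k) ≤ (h - k) u := hφu _ fun x hx => by
      rw [sub_apply, zero_apply]; exact sub_nonneg.2 (hle k hk x hx)
    have h2 := (hcQ hk).2.2
    have h3 : k u ≤ h u := hle k hk u hu
    rw [map_sub, sub_apply] at h1
    have h4 : h u - k u ≤ δ / (1 + |ε|) := by
      simp only at hkδ
      linarith
    have h5 : (1 + |ε|) * (h u - k u) ≤ δ := by
      rw [mul_comm]; exact (le_div_iff₀ (by positivity)).1 h4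
    have h6 : ε * (k u - h u) ≤ |ε| * (h u - k u) := by
      nlinarith [neg_abs_le ε]
    linarith) 0 h0
  obtain ⟨hh0, hhf, hhφ⟩ := hh.prop
  have hg0 : 0 ≤ f - h := fun x hx => by
    rw [sub_apply, zero_apply]; exact sub_nonneg.2 (hhf x hx)
  refine ⟨f - h, hg0, ?_, fun k hk0 hk => ?_⟩
  · rw [map_sub, sub_apply]
    linarith
  by_contra! hlt
  have h1 : h ≤ h + k := fun x hx => by
    rw [add_apply]; exact le_add_of_nonneg_right (hk0 x hx)
  have h2 : h + k ≤ h := hh.le_of_ge ⟨hh0.trans h1, fun x hx => by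
    have := hk x hx
    rw [sub_apply] at this
    rw [add_apply]
    linarith, by
    rw [map_add, add_apply]; linarith⟩ h1
  have h3 : k = 0 := by
    ext x
    have h4 : ∀ z : E, 0 ≤ z → k z = 0 := fun z hz => by
      have h5 := h2 z hz
      rw [add_apply] at h5
      exact le_antisymm (by linarith) (hk0 z hz)
    rw [← posPart_sub_negPart x, map_sub, h4 _ (posPart_nonneg x), h4 _ (negPart_nonneg x)]
    simp
  simp [h3] at hlt

/-- The order density of a Banach lattice with order continuous norm in the order ideal that it
generates in its bidual: a functional `φ` with `0 ≤ φ ≤ u` which is not zero dominates some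
`x > 0`. -/
theorem exists_pos_le_bidual (hE : HasOrderContinuousNorm E) (hdc : DedekindComplete E) {u : E}
    (hu : 0 ≤ u) {φ : StrongDual ℝ (StrongDual ℝ E)}
    (hφ0 : ∀ f : StrongDual ℝ E, 0 ≤ f → 0 ≤ φ f)
    (hφu : ∀ f : StrongDual ℝ E, 0 ≤ f → φ f ≤ f u) {f : StrongDual ℝ E} (hf : 0 ≤ f)
    (hφf : 0 < φ f) :
    ∃ x, 0 ≤ x ∧ x ≤ u ∧ x ≠ 0 ∧ ∀ h : StrongDual ℝ E, 0 ≤ h → h x ≤ φ h := by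
  have hfu : 0 < f u := hφf.trans_le (hφu f hf)
  obtain ⟨ε, hε0, hε⟩ : ∃ ε : ℝ, 0 < ε ∧ ε * f u < φ f :=
    ⟨φ f / (2 * f u), by positivity, by field_simp; linarith⟩
  have hε1 : ε < 1 := by
    by_contra! h
    nlinarith [hφu f hf]
  obtain ⟨g, hg0, hgφ, hg⟩ := exists_hahn hu hφu hf hε
  have hgu : 0 < g u := by
    have h1 := hφu g hg0
    have h2 : 0 ≤ g u := hg0 u hu
    rcases h2.lt_or_eq with h | h
    · exact h
    · rw [← h] at h1 hgφ
      linarith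
  obtain ⟨v, hv0, hvu, hgv, hv⟩ := exists_strictlyPositive hE hdc (g := g) hu
  refine ⟨ε • v, smul_nonneg hε0.le hv0, ?_, ?_, fun h hh => ?_⟩
  · calc ε • v ≤ (1 : ℝ) • v := smul_le_smul_of_nonneg_right hε1.le hv0
      _ ≤ u := by rwa [one_smul]
  · intro h
    rcases smul_eq_zero.1 h with h | h
    · exact hε0.ne' h
    · rw [h, map_zero] at hgv
      exact hgu.ne hgv
  -- `φ ≥ ε u` holds below every multiple of `g`, and the functionals `h ⊓ n g` increase to `h`
  -- at `v` since `g` is strictly positive below `v`.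
  have hlow : ∀ (n : ℕ) (δ : ℝ), (∀ b, 0 ≤ b → b ≤ v → h b - 2 ^ n * g b ≤ δ) →
      ε * (h v - δ) ≤ φ h := by
    intro n δ hδ
    have hn : (0 : ℝ) < 2 ^ n := by positivity
    let p := dualPosPart (h - (2 : ℝ) ^ n • g)
    have hpv : p v ≤ δ := (isLUB_dualPosPart _ hv0).2 (by
      rintro _ ⟨b, hb, rfl⟩
      exact hδ b hb.1 hb.2)
    have hp0 : ∀ x, 0 ≤ x → 0 ≤ p x := fun x hx => dualPosPart_apply_nonneg _ hx
    have hph : ∀ x, 0 ≤ x → p x ≤ h x := fun x hx => (isLUB_dualPosPart _ hx).2 (by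
      rintro _ ⟨b, hb, rfl⟩
      have h1 : 0 ≤ (2 : ℝ) ^ n * g b := mul_nonneg hn.le (hg0 b hb.1)
      have h2 : h b ≤ h x := apply_mono_of_nonneg hh hb.2
      change h b - 2 ^ n * g b ≤ h x
      linarith)
    have hpg : ∀ x, 0 ≤ x → h x - p x ≤ 2 ^ n * g x := fun x hx => by
      have h1 : h x - 2 ^ n * g x ≤ p x :=
        apply_le_dualPosPart (h - (2 : ℝ) ^ n • g) hx le_rfl
      linarith
    have hk0 : ∀ x, 0 ≤ x → 0 ≤ (h - p) x := fun x hx => sub_nonneg.2 (hph x hx)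
    have h1 : ε * (((2 : ℝ) ^ n)⁻¹ • (h - p)) u ≤ φ (((2 : ℝ) ^ n)⁻¹ • (h - p)) :=
      hg _ (fun x hx => mul_nonneg (inv_nonneg.2 hn.le) (hk0 x hx)) fun x hx => by
        change ((2 : ℝ) ^ n)⁻¹ * (h x - p x) ≤ g x
        rw [inv_mul_le_iff₀ hn]
        exact hpg x hx
    have h2 : ε * (h - p) u ≤ φ (h - p) := by
      rw [map_smul, smul_eq_mul, smul_apply, smul_eq_mul, mul_left_comm] at h1
      exact le_of_mul_le_mul_left h1 (inv_pos.2 hn)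
    have h3 : (h - p) v ≤ (h - p) u := apply_mono_of_nonneg hk0 hvu
    have h4 : φ (h - p) ≤ φ h := by
      rw [map_sub]
      linarith [hφ0 p hp0]
    calc ε * (h v - δ) ≤ ε * (h - p) v :=
          mul_le_mul_of_nonneg_left (sub_le_sub_left hpv _) hε0.le
      _ ≤ ε * (h - p) u := mul_le_mul_of_nonneg_left h3 hε0.le
      _ ≤ φ h := h2.trans h4
  have hall : ∀ δ > 0, ε * (h v - δ) ≤ φ h := by
    intro δ hδ
    by_contra hcon
    have hex : ∀ n : ℕ, ∃ b, 0 ≤ b ∧ b ≤ v ∧ δ < h b - 2 ^ n * g b := by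
      intro n
      by_contra! H
      exact hcon (hlow n δ H)
    choose b hb0 hbv hbδ using hex
    have hlim := tendsto_norm_of_strictlyPositive hE hdc hg0 hv hb0 hbv (C := h v) (fun n => by
      have h1 : h (b n) ≤ h v := apply_mono_of_nonneg hh (hbv n)
      have h2 := hbδ n
      rw [one_div, inv_pow, ← div_eq_mul_inv, le_div_iff₀ (by positivity)]
      linarith)
    have hlim' : Tendsto (fun n => h (b n)) atTop (𝓝 (h 0)) :=
      (h.continuous.tendsto 0).comp (tendsto_zero_iff_norm_tendsto_zero.2 hlim)
    rw [map_zero] at hlim'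
    refine absurd (ge_of_tendsto' hlim' fun n => ?_) (not_le.2 hδ)
    have h1 : 0 ≤ 2 ^ n * g (b n) := mul_nonneg (by positivity) (hg0 _ (hb0 n))
    linarith [hbδ n]
  rw [map_smul, smul_eq_mul]
  have hlim : Tendsto (fun δ : ℝ => ε * (h v - δ)) (𝓝[>] 0) (𝓝 (ε * (h v - 0))) :=
    (Continuous.tendsto (by fun_prop) 0).mono_left nhdsWithin_le_nhds
  rw [sub_zero] at hlim
  exact le_of_tendsto hlim (mem_of_superset self_mem_nhdsWithin hall)

open NormedSpace in
/-- A Dedekind complete Banach lattice with order continuous norm is an order ideal in its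
bidual. -/
theorem exists_eq_of_le_bidual (hE : HasOrderContinuousNorm E) (hdc : DedekindComplete E) {u : E}
    (hu : 0 ≤ u) {φ : StrongDual ℝ (StrongDual ℝ E)}
    (hφ0 : ∀ f : StrongDual ℝ E, 0 ≤ f → 0 ≤ φ f)
    (hφu : ∀ f : StrongDual ℝ E, 0 ≤ f → φ f ≤ f u) : ∃ x, ∀ f : StrongDual ℝ E, f x = φ f := by
  have hcl : IsClosed {x : E | ∀ f : StrongDual ℝ E, 0 ≤ f → f x ≤ φ f} := by
    simp only [Set.ofPred_forall]
    exact isClosed_iInter fun f => isClosed_iInter fun _ =>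
      isClosed_le f.continuous continuous_const
  obtain ⟨w, hw⟩ := exists_maximal_of_isClosed hE hdc
    (S := Set.Icc 0 u ∩ {x : E | ∀ f : StrongDual ℝ E, 0 ≤ f → f x ≤ φ f}) (u := u)
    (isClosed_Icc.inter hcl) (fun z hz => hz.1.2)
    ⟨0, ⟨le_rfl, hu⟩, fun f hf => by simpa using hφ0 f hf⟩
  obtain ⟨⟨hw0, hwu⟩, hwφ⟩ := hw.prop
  have hpos : ∀ f : StrongDual ℝ E, 0 ≤ f → f w = φ f := by
    intro f hf
    by_contra hne
    have hlt : 0 < φ f - f w := sub_pos.2 (lt_of_le_of_ne (hwφ f hf) hne)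
    obtain ⟨x, hx0, hxu, hxne, hx⟩ := exists_pos_le_bidual hE hdc (sub_nonneg.2 hwu)
      (φ := φ - inclusionInDoubleDual ℝ E w) (f := f)
      (fun h hh => by simpa using hwφ h hh) (fun h hh => by
        rw [sub_apply, dual_def, map_sub]
        exact sub_le_sub_right (hφu h hh) _) hf (by simpa using hlt)
    have h1 : w ≤ w + x := le_add_of_nonneg_right hx0
    have h2 : w + x ≤ w := hw.le_of_ge ⟨⟨hw0.trans h1, by
      rw [add_comm]; exact le_sub_iff_add_le.1 hxu⟩, fun h hh => by
      have h3 := hx h hh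
      rw [sub_apply, dual_def] at h3
      rw [map_add]
      linarith⟩ h1
    exact hxne (le_antisymm (by simpa using h2) hx0)
  refine ⟨w, fun f => ?_⟩
  have h1 := hpos (dualPosPart f) fun x hx => dualPosPart_apply_nonneg f hx
  have h2 := hpos (dualPosPart f - f) fun x hx => by
    rw [sub_apply, zero_apply]
    exact sub_nonneg.2 (apply_le_dualPosPart f hx le_rfl)
  rw [map_sub, sub_apply] at h2
  linarith

open NormedSpace in
/-- Order intervals of a Dedekind complete Banach lattice with order continuous norm are relatively
weakly compact. -/
theorem relativelyWeaklyCompact_Icc (hE : HasOrderContinuousNorm E) (hdc : DedekindComplete E)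
    {w : E} (hw : 0 ≤ w) : RelativelyWeaklyCompact (Set.Icc (-w) w) := by
  refine isCompact_closure_of_isBounded ℝ E _ ?_ ?_
  · rw [Set.preimage_image_eq _ (toWeakSpace ℝ E).injective]
    exact isBounded_Icc_neg w
  intro Φ hΦ
  have hmem : ∀ f : StrongDual ℝ E, 0 ≤ f → Φ f ∈ Set.Icc (-f w) (f w) := by
    intro f hf
    refine closure_minimal (t := (fun Ψ : WeakDual ℝ (StrongDual ℝ E) => Ψ f) ⁻¹' _) ?_
      (isClosed_Icc.preimage (WeakDual.eval_continuous f)) hΦ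
    rintro _ ⟨_, ⟨x, hx, rfl⟩, rfl⟩
    refine ⟨?_, apply_mono_of_nonneg hf hx.2⟩
    rw [← map_neg]
    exact apply_mono_of_nonneg hf hx.1
  obtain ⟨x, hx⟩ := exists_eq_of_le_bidual hE hdc (add_nonneg hw hw)
    (φ := WeakDual.toStrongDual Φ + inclusionInDoubleDual ℝ E w)
    (fun f hf => by
      rw [add_apply, dual_def, WeakDual.toStrongDual_apply]
      linarith [(hmem f hf).1])
    (fun f hf => by
      rw [add_apply, dual_def, WeakDual.toStrongDual_apply, map_add]
      linarith [(hmem f hf).2])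
  refine ⟨toWeakSpace ℝ E (x - w), DFunLike.ext _ _ fun f => ?_⟩
  have h1 := hx f
  rw [add_apply, dual_def, WeakDual.toStrongDual_apply] at h1
  change f (x - w) = Φ f
  rw [map_sub]
  linarith

end OrderIntervals

/-! ### Disjoint sequences -/

section DisjointSequences

variable {E : Type u} [NormedAddCommGroup E] [NormedSpace ℝ E] [Lattice E] [BanachLattice E]

theorem posPart_inf_posPart (a b : E) : a⁺ ⊓ b⁺ = (a ⊓ b)⁺ := by
  let _ : DistribLattice E := AddCommGroup.toDistribLattice E
  exact (sup_inf_right a b 0).symm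

theorem sub_posPart_le_self {a c : E} (ha : 0 ≤ a) (hc : 0 ≤ c) : (a - c)⁺ ≤ a :=
  sup_le (sub_le_self a hc) ha

/-- Finite sums of disjoint positive elements are suprema. -/
theorem sum_le_of_disjoint {z : ℕ → E} {b : E} (hb : 0 ≤ b) (hz0 : ∀ n, 0 ≤ z n)
    (hzb : ∀ n, z n ≤ b) (hz : Pairwise fun m n => z m ⊓ z n = 0) (n : ℕ) :
    ∑ k ∈ Finset.range n, z k ≤ b := by
  let _ : DistribLattice E := AddCommGroup.toDistribLattice E
  have hd : ∀ n m, n ≤ m → (∑ k ∈ Finset.range n, z k) ⊓ z m = 0 ∧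
      ∑ k ∈ Finset.range n, z k ≤ b := by
    intro n
    induction n with
    | zero => exact fun m _ => ⟨by simpa using hz0 m, by simpa using hb⟩
    | succ n ih =>
      intro m hm
      have hsup : ∑ k ∈ Finset.range (n + 1), z k = (∑ k ∈ Finset.range n, z k) ⊔ z n := by
        rw [Finset.sum_range_succ, ← inf_add_sup, (ih n le_rfl).1, zero_add]
      rw [hsup]
      refine ⟨?_, sup_le (ih n le_rfl).2 (hzb n)⟩
      have h1 : ((∑ k ∈ Finset.range n, z k) ⊔ z n) ⊓ z m =
          ((∑ k ∈ Finset.range n, z k) ⊓ z m) ⊔ (z n ⊓ z m) := inf_sup_right _ _ _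
      rw [h1, (ih m (by omega)).1, hz (by omega : n ≠ m), sup_idem]
  exact (hd n n le_rfl).2

/-- If `x n` is in `[-w, w]` up to `ε`, then `|x n|` is within `ε` of `|x n| ⊓ w`, and the latter form
a disjoint order bounded sequence, hence the terms of a bounded series. -/
theorem BoundedSeriesNull.tendsto_of_disjointSeq (hE : BoundedSeriesNull E) {x : ℕ → E}
    (hx : DisjointSeq x) (hb : AlmostOrderBounded (Set.range x)) :
    Tendsto (fun n => ‖x n‖) atTop (𝓝 0) := by
  refine Metric.tendsto_atTop.2 fun ε hε => ?_
  obtain ⟨w, hw, hxw⟩ := hb (ε / 2) (half_pos hε)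
  have hlim := hE (fun n => |x n| ⊓ w) w (fun n => le_inf (abs_nonneg _) hw)
    (sum_le_of_disjoint hw (fun n => le_inf (abs_nonneg _) hw) (fun n => inf_le_right)
      fun m n hmn => le_antisymm
        ((inf_le_inf inf_le_left inf_le_left).trans (hx hmn).le)
        (le_inf (le_inf (abs_nonneg _) hw) (le_inf (abs_nonneg _) hw)))
  obtain ⟨N, hN⟩ := Metric.tendsto_atTop.1 hlim (ε / 2) (half_pos hε)
  refine ⟨N, fun n hn => ?_⟩
  have h1 := hN n hn
  rw [Real.dist_0_eq_abs, abs_of_nonneg (norm_nonneg _)] at h1 ⊢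
  obtain ⟨y, hy, z, hz, hyz⟩ := hxw ⟨n, rfl⟩
  rw [mem_closedBall_zero_iff] at hz
  have h2 : |x n| ≤ |x n| ⊓ w + |z| := by
    rw [inf_add]
    refine le_inf (le_add_of_nonneg_right (abs_nonneg z)) ?_
    rw [← hyz]
    exact (abs_add_le y z).trans (add_le_add_left (abs_le'.2 ⟨hy.2, neg_le.1 hy.1⟩) _)
  calc ‖x n‖ = ‖|x n|‖ := (norm_abs_eq_norm _).symm
    _ ≤ ‖|x n| ⊓ w + |z|‖ := norm_le_norm_of_nonneg_of_le (abs_nonneg _) h2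
    _ ≤ ‖|x n| ⊓ w‖ + ‖|z|‖ := norm_add_le _ _
    _ < ε / 2 + ε / 2 := add_lt_add_of_lt_of_le h1 (by rwa [norm_abs_eq_norm])
    _ = ε := add_halves ε

/-- Every positive, order bounded, pairwise disjoint sequence is norm null. -/
def DisjointSeqNull (E : Type u) [NormedAddCommGroup E] [Lattice E] : Prop :=
  ∀ (z : ℕ → E) (b : E), (∀ n, 0 ≤ z n) → (∀ n, z n ≤ b) →
    (Pairwise fun m n => z m ⊓ z n = 0) → Tendsto (fun n => ‖z n‖) atTop (𝓝 0)

/-- Asymptotically disjoint order bounded sequences are norm null as soon as disjoint ones are: a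
subsequence can be perturbed to a disjoint sequence. -/
theorem DisjointSeqNull.tendsto_of_inf_tendsto (hE : DisjointSeqNull E) {z : ℕ → E} {b : E}
    (hz0 : ∀ n, 0 ≤ z n) (hzb : ∀ n, z n ≤ b)
    (hz : ∀ m, Tendsto (fun n => ‖z m ⊓ z n‖) atTop (𝓝 0)) :
    Tendsto (fun n => ‖z n‖) atTop (𝓝 0) := by
  by_contra hcon
  obtain ⟨ε, hε, hfreq⟩ : ∃ ε > 0, ∀ N, ∃ n ≥ N, ε ≤ ‖z n‖ := by
    rw [Metric.tendsto_atTop] at hcon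
    push Not at hcon
    simpa using hcon
  obtain ⟨f, hf, hfr⟩ := exists_seq_of_forall_finset_exists (α := ℕ × ℕ)
    (fun p => ε ≤ ‖z p.2‖)
    (fun p q => p.1 < q.1 ∧ ‖z p.2 ⊓ z q.2‖ ≤ ε / 4 * (1 / 2) ^ p.1 * (1 / 2) ^ q.1) (by
      intro s _
      let K := s.sup Prod.fst + 1
      have hev : ∀ᶠ n in atTop, ∀ p ∈ s,
          ‖z p.2 ⊓ z n‖ ≤ ε / 4 * (1 / 2) ^ p.1 * (1 / 2) ^ K :=
        (Finset.eventually_all s).2 fun p _ => (hz p.2).eventually (ge_mem_nhds (by positivity))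
      obtain ⟨N, hN⟩ := eventually_atTop.1 hev
      obtain ⟨n, hn, hnε⟩ := hfreq N
      exact ⟨(K, n), hnε, fun p hp =>
        ⟨Nat.lt_succ_of_le (Finset.le_sup (f := Prod.fst) hp), hN n hn p hp⟩⟩)
  have hmono : StrictMono fun k => (f k).1 := fun m n hmn => (hfr m n hmn).1
  let a : ℕ → E := fun k => z (f k).2
  have ha0 : ∀ k, 0 ≤ a k := fun k => hz0 _
  have hlt : ∀ j k, j < k → ‖a j ⊓ a k‖ ≤ ε / 4 * (1 / 2) ^ j * (1 / 2) ^ k := fun j k hjk =>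
    (hfr j k hjk).2.trans (mul_le_mul (mul_le_mul_of_nonneg_left
      (pow_le_pow_of_le_one (by norm_num) (by norm_num) (hmono.le_apply (x := j)))
        (by positivity))
      (pow_le_pow_of_le_one (by norm_num) (by norm_num) (hmono.le_apply (x := k)))
      (by positivity) (by positivity))
  -- `o j k` is the overlap of `a j` and `a k`, and `c k` the sum of the overlaps with `a k`.
  let o : ℕ → ℕ → E := fun j k => if j = k then 0 else a j ⊓ a k
  have ho0 : ∀ j k, 0 ≤ o j k := fun j k => by
    by_cases h : j = k
    · simp [o, h]
    · simpa [o, h] using ⟨ha0 j, ha0 k⟩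
  have ho : ∀ k j, ‖o j k‖ ≤ ε / 4 * (1 / 2) ^ k * (1 / 2) ^ j := by
    intro k j
    rcases lt_trichotomy j k with h | h | h
    · simpa [o, h.ne, mul_right_comm] using hlt j k h
    · simp only [o, h, if_true, norm_zero]; positivity
    · simpa [o, h.ne', inf_comm] using hlt k j h
  have hgeo : ∀ k, HasSum (fun j => ε / 4 * (1 / 2 : ℝ) ^ k * (1 / 2) ^ j)
      (ε / 4 * (1 / 2) ^ k * 2) := fun k => hasSum_geometric_two.mul_left _
  let c : ℕ → E := fun k => ∑' j, o j k
  have hsum : ∀ k, Summable fun j => o j k := fun k =>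
    Summable.of_norm_bounded (hgeo k).summable (ho k)
  have hoc : ∀ j k, o j k ≤ c k := fun j k => (hsum k).le_tsum j fun i _ => ho0 i k
  have hc0 : ∀ k, 0 ≤ c k := fun k => tsum_nonneg fun j => ho0 j k
  have hc : ∀ k, ‖c k‖ ≤ ε / 2 := fun k => by
    refine (tsum_of_norm_bounded (hgeo k) (ho k)).trans ?_
    have : (1 / 2 : ℝ) ^ k ≤ 1 := pow_le_one₀ (by norm_num) (by norm_num)
    nlinarith
  have hdisj : Pairwise fun j k => (a j - c j)⁺ ⊓ (a k - c k)⁺ = 0 := by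
    intro j k hjk
    rw [posPart_inf_posPart, posPart_eq_zero]
    have h1 : a j ⊓ a k ≤ c k := by simpa [o, hjk] using hoc j k
    have h2 : a j ⊓ a k ≤ c j := by simpa [o, hjk.symm, inf_comm] using hoc k j
    calc (a j - c j) ⊓ (a k - c k) ≤ (a j - a j ⊓ a k) ⊓ (a k - a j ⊓ a k) :=
          inf_le_inf (sub_le_sub_left h2 _) (sub_le_sub_left h1 _)
      _ = 0 := by rw [← inf_sub, sub_self]
  have hlim := hE (fun k => (a k - c k)⁺) b (fun k => posPart_nonneg _)
    (fun k => (sub_posPart_le_self (ha0 k) (hc0 k)).trans (hzb _)) hdisj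
  obtain ⟨k, hk⟩ := (hlim.eventually (gt_mem_nhds (half_pos hε))).exists
  have h1 : a k ≤ (a k - c k)⁺ + c k := sub_le_iff_le_add.1 (le_posPart _)
  have h2 := (norm_le_norm_of_nonneg_of_le (ha0 k) h1).trans (norm_add_le _ _)
  have h3 : ε ≤ ‖a k‖ := hf k
  linarith [hc k]

/-- If `K e + ∑ y n ≤ b ≤ (K + N) c`, then at each point fewer than `N` of the `e ⊓ y n` can
exceed `c`; the truncations `(e ⊓ y n - c)⁺` are norm null by induction on this multiplicity. -/
theorem DisjointSeqNull.tendsto_truncation (hE : DisjointSeqNull E) {b c : E} (hc : 0 ≤ c)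
    (N : ℕ) : ∀ (K : ℕ) (e : E) (y : ℕ → E), 1 ≤ K → 0 ≤ e → (∀ n, 0 ≤ y n) →
      (∀ n, (K : ℝ) • e + ∑ k ∈ Finset.range n, y k ≤ b) → b ≤ ((K + N : ℕ) : ℝ) • c →
      Tendsto (fun n => ‖(e ⊓ y n - c)⁺‖) atTop (𝓝 0) := by
  induction N with
  | zero =>
    intro K e y hK he hy hb hbc
    have h1 : (K : ℝ) • e ≤ (K : ℝ) • c := by simpa using (hb 0).trans hbc
    have h2 : e ≤ c := le_of_smul_le_smul_left h1 (by exact_mod_cast hK)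
    have h3 : ∀ n, (e ⊓ y n - c)⁺ = 0 := fun n =>
      posPart_eq_zero.2 (sub_nonpos.2 (inf_le_left.trans h2))
    simp [h3]
  | succ N ih =>
    intro K e y hK he hy hb hbc
    refine hE.tendsto_of_inf_tendsto (b := e) (fun n => posPart_nonneg _)
      (fun n => (sub_posPart_le_self (le_inf he (hy n)) hc).trans inf_le_left) fun m => ?_
    refine (tendsto_add_atTop_iff_nat (m + 1)).1 ?_
    have h1 := ih (K + 1) (e ⊓ y m) (fun n => y (n + (m + 1))) (by omega) (le_inf he (hy m))
      (fun n => hy _) (fun n => by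
        refine le_trans ?_ (hb (m + 1 + n))
        rw [Finset.sum_range_add, Nat.cast_add, Nat.cast_one, add_smul, one_smul, add_assoc]
        refine add_le_add (smul_le_smul_of_nonneg_left inf_le_left (Nat.cast_nonneg K))
          (add_le_add (inf_le_right.trans ?_) (le_of_eq ?_))
        · exact Finset.single_le_sum (fun i _ => hy i) (Finset.mem_range.2 (Nat.lt_succ_self m))
        · exact Finset.sum_congr rfl fun i _ => by rw [add_comm])
      (by rwa [add_right_comm, add_assoc])
    refine h1.congr fun n => ?_
    rw [posPart_inf_posPart, ← inf_sub]
    congr 3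
    exact le_antisymm (le_inf inf_le_left (le_inf (inf_le_left.trans inf_le_left) inf_le_right))
      (le_inf inf_le_left (inf_le_right.trans inf_le_right))

/-- Each `y n ≤ b` is within `δ b` of its truncation `(y n - δ b)⁺`, and the truncations are norm
null by `DisjointSeqNull.tendsto_truncation`. -/
theorem DisjointSeqNull.boundedSeriesNull (hE : DisjointSeqNull E) : BoundedSeriesNull E := by
  intro y b hy hb
  have hb0 : 0 ≤ b := by simpa using hb 0
  have hyb : ∀ n, y n ≤ b := fun n =>
    (Finset.single_le_sum (fun i _ => hy i) (Finset.mem_range.2 (Nat.lt_succ_self n))).trans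
      (hb (n + 1))
  refine Metric.tendsto_atTop.2 fun ε hε => ?_
  obtain ⟨δ, hδ, hδb⟩ : ∃ δ : ℝ, 0 < δ ∧ δ * ‖b‖ ≤ ε / 2 :=
    ⟨ε / 2 / (‖b‖ + 1), by positivity, by
      rw [div_mul_eq_mul_div]
      exact (div_le_iff₀ (by positivity)).2 (by nlinarith [norm_nonneg b])⟩
  have hc : 0 ≤ δ • b := smul_nonneg hδ.le hb0
  obtain ⟨N, hN⟩ := exists_nat_ge (2 / δ)
  have hlim := hE.tendsto_truncation (b := b + b) hc N 1 b y le_rfl hb0 hy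
    (fun n => by simpa using hb n) (by
      rw [smul_smul, ← two_smul ℝ b]
      refine smul_le_smul_of_nonneg_right ?_ hb0
      rw [div_le_iff₀ hδ] at hN
      push_cast
      linarith)
  obtain ⟨M, hM⟩ := Metric.tendsto_atTop.1 hlim (ε / 2) (half_pos hε)
  refine ⟨M, fun n hn => ?_⟩
  have h1 := hM n hn
  rw [Real.dist_0_eq_abs, abs_of_nonneg (norm_nonneg _)] at h1 ⊢
  rw [inf_eq_right.2 (hyb n)] at h1
  have h2 : y n ≤ (y n - δ • b)⁺ + δ • b := sub_le_iff_le_add.1 (le_posPart _)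
  have h3 := (norm_le_norm_of_nonneg_of_le (hy n) h2).trans (norm_add_le _ _)
  rw [norm_smul, Real.norm_of_nonneg hδ.le] at h3
  linarith

theorem almostOrderBounded_of_subset_Icc {E : Type u} [NormedAddCommGroup E] [Preorder E] {A : Set E}
    {w : E} (hw : 0 ≤ w) (hA : A ⊆ Set.Icc (-w) w) : AlmostOrderBounded A := fun ε hε => by
  obtain ⟨v, hv, h⟩ := almostOrderBounded_Icc w hw ε hε
  exact ⟨v, hv, hA.trans h⟩

theorem disjointSeqNull_of_almostOrderBounded
    (h : ∀ x : ℕ → E, DisjointSeq x → AlmostOrderBounded (Set.range x) →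
      Tendsto (fun n => ‖x n‖) atTop (𝓝 0)) : DisjointSeqNull E := by
  intro z b hz0 hzb hz
  have hb0 : 0 ≤ b := (hz0 0).trans (hzb 0)
  refine h z (fun m n hmn => ?_) (almostOrderBounded_of_subset_Icc hb0 ?_)
  · simpa only [abs_of_nonneg (hz0 _)] using hz hmn
  · rintro _ ⟨n, rfl⟩
    exact ⟨(neg_nonpos.2 hb0).trans (hz0 n), hzb n⟩

end DisjointSequences

/-! ### Completion of a lattice with a solid seminorm -/

section Completion

open UniformSpace

variable {L : Type u} [SeminormedAddCommGroup L] [Lattice L] [IsOrderedAddMonoid L]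

theorem sup_sub_sup_abs_le (a b c d : L) : |a ⊔ b - c ⊔ d| ≤ |a - c| + |b - d| :=
  calc |a ⊔ b - c ⊔ d| = |(a ⊔ b - c ⊔ b) + (c ⊔ b - c ⊔ d)| := by rw [sub_add_sub_cancel]
    _ ≤ |a ⊔ b - c ⊔ b| + |c ⊔ b - c ⊔ d| := abs_add_le _ _
    _ ≤ |a - c| + |b - d| := by
      refine add_le_add (abs_sup_sub_sup_le_abs a c b) ?_
      rw [sup_comm c b, sup_comm c d]
      exact abs_sup_sub_sup_le_abs b d c

theorem norm_abs_eq_of_solid (hL : ∀ x y : L, |x| ≤ |y| → ‖x‖ ≤ ‖y‖) (x : L) : ‖|x|‖ = ‖x‖ :=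
  le_antisymm (hL _ _ (abs_abs x).le) (hL _ _ (abs_abs x).ge)

theorem uniformContinuous₂_sup (hL : ∀ x y : L, |x| ≤ |y| → ‖x‖ ≤ ‖y‖) :
    UniformContinuous₂ fun x y : L => x ⊔ y := by
  refine Metric.uniformContinuous_iff.2 fun ε hε => ⟨ε / 2, half_pos hε, ?_⟩
  rintro ⟨a, b⟩ ⟨c, d⟩ h
  rw [Prod.dist_eq, max_lt_iff, dist_eq_norm, dist_eq_norm] at h
  change dist (a ⊔ b) (c ⊔ d) < ε
  rw [dist_eq_norm]
  calc ‖a ⊔ b - c ⊔ d‖ ≤ ‖|a - c| + |b - d|‖ := hL _ _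
        ((sup_sub_sup_abs_le a b c d).trans (le_abs_self _))
    _ ≤ ‖|a - c|‖ + ‖|b - d|‖ := norm_add_le _ _
    _ < ε := by
      rw [norm_abs_eq_of_solid hL, norm_abs_eq_of_solid hL]
      linarith [h.1, h.2]

/-- The completion of a lattice ordered space with a solid seminorm is a Banach lattice. The
lattice operations are the continuous extensions of those of the space. -/
theorem exists_lattice_completion [NormedSpace ℝ L] [IsOrderedModule ℝ L]
    (hL : ∀ x y : L, |x| ≤ |y| → ‖x‖ ≤ ‖y‖) :
    ∃ (_ : Lattice (Completion L)) (_ : BanachLattice (Completion L)),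
      ∀ x y : L, ((x ⊔ y : L) : Completion L) = (x : Completion L) ⊔ (y : Completion L) := by
  let S : Completion L → Completion L → Completion L := Completion.map₂ fun x y : L => x ⊔ y
  have hS : ∀ x y : L, S x y = ((x ⊔ y : L) : Completion L) := fun x y =>
    Completion.map₂_coe_coe x y _ (uniformContinuous₂_sup hL)
  have hSc : ∀ {X : Type u} [TopologicalSpace X] {f g : X → Completion L}, Continuous f →
      Continuous g → Continuous fun x => S (f x) (g x) := fun hf hg =>
    Completion.continuous_map₂ hf hg
  let I : Completion L → Completion L → Completion L := fun x y => -S (-x) (-y)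
  have hI : ∀ x y : L, I x y = ((x ⊓ y : L) : Completion L) := fun x y => by
    change -S (-x) (-y) = _
    rw [← Completion.coe_neg, ← Completion.coe_neg, hS, ← Completion.coe_neg, neg_sup, neg_neg,
      neg_neg]
  have hIc : ∀ {X : Type u} [TopologicalSpace X] {f g : X → Completion L}, Continuous f →
      Continuous g → Continuous fun x => I (f x) (g x) := fun hf hg => (hSc hf.neg hg.neg).neg
  let instMax : Max (Completion L) := ⟨S⟩
  let instMin : Min (Completion L) := ⟨I⟩
  have sup_comm' : ∀ a b : Completion L, a ⊔ b = b ⊔ a := fun a b =>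
    Completion.induction_on₂ a b
      (isClosed_eq (hSc continuous_fst continuous_snd) (hSc continuous_snd continuous_fst))
      fun x y => by change S x y = S y x; rw [hS, hS, sup_comm]
  have inf_comm' : ∀ a b : Completion L, a ⊓ b = b ⊓ a := fun a b => by
    change -((-a) ⊔ (-b)) = -((-b) ⊔ (-a))
    rw [sup_comm']
  have sup_assoc' : ∀ a b c : Completion L, a ⊔ b ⊔ c = a ⊔ (b ⊔ c) := fun a b c =>
    Completion.induction_on₃ a b c
      (isClosed_eq (hSc (hSc continuous_fst continuous_snd.fst) continuous_snd.snd)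
        (hSc continuous_fst (hSc continuous_snd.fst continuous_snd.snd)))
      fun x y z => by
        change S (S x y) z = S x (S y z)
        rw [hS, hS, hS, hS, sup_assoc]
  have inf_assoc' : ∀ a b c : Completion L, a ⊓ b ⊓ c = a ⊓ (b ⊓ c) := fun a b c => by
    change -(-(-(-a ⊔ -b)) ⊔ -c) = -(-a ⊔ -(-(-b ⊔ -c)))
    rw [neg_neg, neg_neg, sup_assoc']
  have sup_inf_self' : ∀ a b : Completion L, a ⊔ a ⊓ b = a := fun a b =>
    Completion.induction_on₂ a b
      (isClosed_eq (hSc continuous_fst (hIc continuous_fst continuous_snd)) continuous_fst)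
      fun x y => by change S x (I x y) = x; rw [hI, hS, sup_inf_self]
  have inf_sup_self' : ∀ a b : Completion L, a ⊓ (a ⊔ b) = a := fun a b =>
    Completion.induction_on₂ a b
      (isClosed_eq (hIc continuous_fst (hSc continuous_fst continuous_snd)) continuous_fst)
      fun x y => by change I x (S x y) = x; rw [hS, hI, inf_sup_self]
  let instLattice : Lattice (Completion L) :=
    Lattice.mk' sup_comm' sup_assoc' inf_comm' inf_assoc' sup_inf_self' inf_sup_self'
  have hcoe : ∀ x y : L, ((x ⊔ y : L) : Completion L) = (x : Completion L) ⊔ (y : Completion L) :=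
    fun x y => (hS x y).symm
  have add_sup' : ∀ a b c : Completion L, a ⊔ b + c = (a + c) ⊔ (b + c) := fun a b c =>
    Completion.induction_on₃ a b c
      (isClosed_eq ((hSc continuous_fst continuous_snd.fst).add continuous_snd.snd)
        (hSc (continuous_fst.add continuous_snd.snd) (continuous_snd.fst.add continuous_snd.snd)))
      fun x y z => by
        rw [← hcoe, ← Completion.coe_add, ← Completion.coe_add, ← Completion.coe_add, ← hcoe,
          sup_add]
  have instAdd : IsOrderedAddMonoid (Completion L) :=
    { add_le_add_left := fun a b h c => by
        rw [← sup_eq_right] at h ⊢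
        rw [← add_sup', h] }
  have smul_nonneg' : ∀ (r : ℝ), 0 ≤ r → ∀ a : Completion L, 0 ≤ a → 0 ≤ r • a := by
    intro r hr a ha
    have h : ∀ a : Completion L, r • (0 ⊔ a) = 0 ⊔ r • a := fun a =>
      Completion.induction_on a
        (isClosed_eq ((hSc continuous_const continuous_id).const_smul r)
          (hSc continuous_const (continuous_const_smul r)))
        fun x => by
          rw [← Completion.coe_zero, ← hcoe, ← Completion.coe_smul, ← Completion.coe_smul, ← hcoe]
          congr 1
          rcases hr.eq_or_lt with rfl | hr
          · simp
          · exact ((OrderIso.smulRight (β := L) hr).map_sup 0 x).trans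
              (congrArg (· ⊔ r • x) (smul_zero r))
    rw [← sup_eq_right] at ha ⊢
    rw [← h, ha]
  have instSMul : IsOrderedModule ℝ (Completion L) := .of_smul_nonneg fun r hr a ha =>
    smul_nonneg' r hr a ha
  have norm_abs' : ∀ a : Completion L, ‖|a|‖ = ‖a‖ := fun a =>
    Completion.induction_on a
      (isClosed_eq (hSc continuous_id continuous_neg).norm continuous_norm)
      fun x => by
        change ‖(x : Completion L) ⊔ -(x : Completion L)‖ = _
        rw [← Completion.coe_neg, ← hcoe, Completion.norm_coe, Completion.norm_coe]
        exact norm_abs_eq_of_solid hL x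
  have norm_le' : ∀ a b : Completion L, ‖a‖ ≤ ‖|a| ⊔ |b|‖ := fun a b =>
    Completion.induction_on₂ a b
      (isClosed_le continuous_fst.norm (hSc (hSc continuous_fst continuous_fst.neg)
        (hSc continuous_snd continuous_snd.neg)).norm)
      fun x y => by
        change ‖(x : Completion L)‖ ≤ ‖((x : Completion L) ⊔ -(x : Completion L)) ⊔
          ((y : Completion L) ⊔ -(y : Completion L))‖
        rw [← Completion.coe_neg, ← Completion.coe_neg, ← hcoe, ← hcoe, ← hcoe,
          Completion.norm_coe, Completion.norm_coe]
        refine hL _ _ ?_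
        change |x| ≤ |(|x| ⊔ |y|)|
        rw [abs_of_nonneg (le_sup_of_le_left (abs_nonneg x))]
        exact le_sup_left
  refine ⟨instLattice,
    { toIsOrderedAddMonoid := instAdd
      toIsOrderedModule := instSMul
      solid := fun a b hab => ?_
      toCompleteSpace := inferInstance }, hcoe⟩
  calc ‖a‖ ≤ ‖|a| ⊔ |b|‖ := norm_le' a b
    _ = ‖b‖ := by rw [sup_eq_right.2 hab, norm_abs']

end Completion

section SeminormCompletion

/-- A vector lattice with a solid seminorm `q` maps onto a dense vector sublattice of a Banach
lattice in which the norm induces `q`. -/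
theorem exists_banachLattice_of_seminorm {E : Type u} [AddCommGroup E] [Module ℝ E] [Lattice E]
    [IsOrderedAddMonoid E] [IsOrderedModule ℝ E] (q : Seminorm ℝ E)
    (hq : ∀ x y : E, |x| ≤ |y| → q x ≤ q y) :
    ∃ (G : Type u) (_ : NormedAddCommGroup G) (_ : NormedSpace ℝ G) (_ : Lattice G)
      (_ : BanachLattice G) (j : E →ₗ[ℝ] G), DenseRange j ∧ (∀ x, ‖j x‖ = q x) ∧
        ∀ x y, j (x ⊔ y) = j x ⊔ j y := by
  let _ : SeminormedAddCommGroup E := q.toAddGroupSeminorm.toSeminormedAddCommGroup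
  let _ : NormedSpace ℝ E := { norm_smul_le := fun a b => (map_smul_eq_mul q a b).le }
  obtain ⟨h1, h2, h3⟩ := exists_lattice_completion (L := E) hq
  exact ⟨UniformSpace.Completion E, inferInstance, inferInstance, h1, h2,
    (UniformSpace.Completion.toComplL (𝕜 := ℝ) (E := E)).toLinearMap,
    UniformSpace.Completion.denseRange_coe, fun x => UniformSpace.Completion.norm_coe x, h3⟩

end SeminormCompletion

/-! ### Banach lattices with a dense sublattice -/

section DenseSublattice

/-- A Banach lattice `G` inherits `BoundedSeriesNull` from a dense vector sublattice in which order
bounded increasing sequences are norm Cauchy. -/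
theorem boundedSeriesNull_of_denseRange {E : Type u} [AddCommGroup E] [Module ℝ E] [Lattice E]
    [IsOrderedAddMonoid E] {G : Type v} [NormedAddCommGroup G] [NormedSpace ℝ G]
    [Lattice G] [BanachLattice G] {j : E →ₗ[ℝ] G} (hj : DenseRange j)
    (hsup : ∀ x y, j (x ⊔ y) = j x ⊔ j y)
    (hcauchy : ∀ (v : E) (x : ℕ → E), 0 ≤ v → Monotone x → (∀ n, 0 ≤ x n) → (∀ n, x n ≤ v) →
      CauchySeq fun n => j (x n)) : BoundedSeriesNull G := by
  have hinf : ∀ x y, j (x ⊓ y) = j x ⊓ j y := fun x y => by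
    have h := hsup (-x) (-y)
    rw [← neg_inf, map_neg, map_neg, map_neg, ← neg_inf] at h
    exact neg_injective h
  intro y b hy hb
  have hb0 : 0 ≤ b := by simpa using hb 0
  let s : ℕ → G := fun n => ∑ k ∈ Finset.range n, y k
  have hs0 : ∀ n, 0 ≤ s n := fun n => Finset.sum_nonneg fun k _ => hy k
  have hsmono : Monotone s := monotone_nat_of_le_succ fun n => by
    change ∑ k ∈ Finset.range n, y k ≤ ∑ k ∈ Finset.range (n + 1), y k
    rw [Finset.sum_range_succ]; exact le_add_of_nonneg_right (hy n)
  have hsy : ∀ n, s (n + 1) - s n = y n := fun n => by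
    simp [s, Finset.sum_range_succ]
  refine Metric.tendsto_atTop.2 fun ε hε => ?_
  obtain ⟨η, hη, hηε⟩ : ∃ η : ℝ, 0 < η ∧ 5 * η < ε := ⟨ε / 6, by positivity, by linarith⟩
  obtain ⟨v₀, hv₀⟩ := hj.exists_dist_lt b hη
  -- `b` is approximated by the image of a positive element `v`.
  obtain ⟨v, hv0, hv⟩ : ∃ v : E, 0 ≤ v ∧ ‖b - j v‖ ≤ η := by
    refine ⟨v₀ ⊔ 0, le_sup_right, ?_⟩
    rw [dist_eq_norm] at hv₀
    calc ‖b - j (v₀ ⊔ 0)‖ = ‖b ⊔ 0 - j v₀ ⊔ 0‖ := by rw [hsup, map_zero, sup_eq_left.2 hb0]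
      _ ≤ ‖b - j v₀‖ := norm_sup_sub_sup_le_norm _ _ _
      _ ≤ η := hv₀.le
  have hjv : 0 ≤ j v := by rw [← sup_eq_left, ← map_zero j, ← hsup, sup_eq_left.2 hv0]
  let t : ℕ → G := fun n => s n ⊓ j v
  have ht0 : ∀ n, 0 ≤ t n := fun n => le_inf (hs0 n) hjv
  have htv : ∀ n, t n ≤ j v := fun n => inf_le_right
  have htmono : Monotone t := fun m n hmn => inf_le_inf_right _ (hsmono hmn)
  have hst : ∀ n, ‖s n - t n‖ ≤ η := by
    intro n
    calc ‖s n - t n‖ = ‖b ⊓ s n - j v ⊓ s n‖ := by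
          rw [inf_eq_right.2 (hb n : s n ≤ b), inf_comm (j v)]
      _ ≤ ‖b - j v‖ := norm_inf_sub_inf_le_norm _ _ _
      _ ≤ η := hv
  have hex : ∀ n, ∃ x : E, 0 ≤ x ∧ x ≤ v ∧ ‖j x - t n‖ ≤ η / 2 * (1 / 2) ^ n := by
    intro n
    obtain ⟨a, ha⟩ := hj.exists_dist_lt (t n) (show 0 < η / 2 * (1 / 2) ^ n by positivity)
    refine ⟨(a ⊔ 0) ⊓ v, le_inf le_sup_right hv0, inf_le_right, ?_⟩
    rw [dist_comm, dist_eq_norm] at ha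
    calc ‖j ((a ⊔ 0) ⊓ v) - t n‖ = ‖(j a ⊔ 0) ⊓ j v - (t n ⊔ 0) ⊓ j v‖ := by
          rw [hinf, hsup, map_zero, sup_eq_left.2 (ht0 n), inf_eq_left.2 (htv n)]
      _ ≤ ‖j a ⊔ 0 - t n ⊔ 0‖ := norm_inf_sub_inf_le_norm _ _ _
      _ ≤ ‖j a - t n‖ := norm_sup_sub_sup_le_norm _ _ _
      _ ≤ _ := ha.le
  choose x hx0 hxv hxt using hex
  -- Passing to finite suprema makes the approximating sequence increasing.
  let X : ℕ →o E := partialSups x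
  have hXt : ∀ n, ‖j (X n) - t n‖ ≤ ∑ k ∈ Finset.range (n + 1), η / 2 * (1 / 2 : ℝ) ^ k := by
    intro n
    induction n with
    | zero => simpa [X] using hxt 0
    | succ n ih =>
      rw [Finset.sum_range_succ]
      calc ‖j (X (n + 1)) - t (n + 1)‖ = ‖j (X n) ⊔ j (x (n + 1)) - t n ⊔ t (n + 1)‖ := by
            rw [sup_eq_right.2 (htmono (Nat.le_succ n)), ← hsup]
            congr 3
            exact partialSups_add_one x n
        _ ≤ ‖j (X n) - t n‖ + ‖j (x (n + 1)) - t (n + 1)‖ := norm_sup_sub_sup_le_add_norm _ _ _ _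
        _ ≤ _ := add_le_add ih (hxt (n + 1))
  have hXt' : ∀ n, ‖j (X n) - t n‖ ≤ η := fun n => by
    refine (hXt n).trans ?_
    rw [← Finset.mul_sum]
    linarith [mul_le_mul_of_nonneg_left (sum_geometric_two_le (n + 1)) (half_pos hη).le]
  have hX := hcauchy v X hv0 X.monotone (fun n => (hx0 0).trans (le_partialSups_of_le x n.zero_le))
    (fun n => partialSups_le _ _ _ fun k _ => hxv k)
  obtain ⟨N, hN⟩ := Metric.cauchySeq_iff.1 hX η hη
  refine ⟨N, fun n hn => ?_⟩
  have h1 := hN (n + 1) (by omega) n hn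
  rw [dist_eq_norm] at h1
  rw [Real.dist_0_eq_abs, abs_of_nonneg (norm_nonneg _), ← hsy]
  have h2 : s (n + 1) - s n = (s (n + 1) - t (n + 1)) - (j (X (n + 1)) - t (n + 1)) +
      (j (X (n + 1)) - j (X n)) + (j (X n) - t n) - (s n - t n) := by abel
  have h3 := norm_sub_le ((s (n + 1) - t (n + 1)) - (j (X (n + 1)) - t (n + 1)) +
      (j (X (n + 1)) - j (X n)) + (j (X n) - t n)) (s n - t n)
  have h4 := norm_add_le ((s (n + 1) - t (n + 1)) - (j (X (n + 1)) - t (n + 1)) +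
      (j (X (n + 1)) - j (X n))) (j (X n) - t n)
  have h5 := norm_add_le ((s (n + 1) - t (n + 1)) - (j (X (n + 1)) - t (n + 1)))
    (j (X (n + 1)) - j (X n))
  have h6 := norm_sub_le (s (n + 1) - t (n + 1)) (j (X (n + 1)) - t (n + 1))
  rw [← h2] at h3
  linarith [hst n, hst (n + 1), hXt' n, hXt' (n + 1)]

end DenseSublattice

/-! ### Almost order-weakly compact operators -/

section Operators

/-- Almost order bounded sets are uniformly approximated by order intervals, so almost order-weak
compactness can be tested on order intervals. -/
theorem isAOWeaklyCompact_of_Icc {E : Type u} [NormedAddCommGroup E] [NormedSpace ℝ E] [Preorder E]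
    {F : Type v} [NormedAddCommGroup F] [NormedSpace ℝ F] [CompleteSpace F] (T : E →L[ℝ] F)
    (hE : ∀ w : E, 0 ≤ w → Bornology.IsBounded (Set.Icc (-w) w))
    (hT : ∀ w : E, 0 ≤ w → RelativelyWeaklyCompact (T '' Set.Icc (-w) w)) :
    IsAOWeaklyCompact (T : E →ₗ[ℝ] F) := by
  refine ⟨T.continuous, fun A hA => relativelyWeaklyCompact_of_approx fun ε hε => ?_⟩
  have hδ : 0 < ε / (‖T‖ + 1) := by positivity
  obtain ⟨w, hw, hAw⟩ := hA _ hδ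
  refine ⟨T '' Set.Icc (-w) w, T.lipschitz.isBounded_image (hE w hw), hT w hw, ?_⟩
  rintro _ ⟨a, ha, rfl⟩
  obtain ⟨y, hy, z, hz, rfl⟩ := hAw ha
  refine ⟨T y, ⟨y, hy, rfl⟩, T z, ?_, (map_add T y z).symm⟩
  rw [mem_closedBall_zero_iff] at hz ⊢
  calc ‖T z‖ ≤ ‖T‖ * ‖z‖ := T.le_opNorm z
    _ ≤ (‖T‖ + 1) * (ε / (‖T‖ + 1)) :=
      mul_le_mul (by linarith) hz (norm_nonneg _) (by positivity)
    _ = ε := mul_div_cancel₀ _ (by positivity)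

variable {E : Type u} [NormedAddCommGroup E] [NormedSpace ℝ E] [Lattice E] [BanachLattice E]
  {F : Type v} [NormedAddCommGroup F] [NormedSpace ℝ F] [Lattice F] [BanachLattice F]

/-- If `± T ≤ S`, then `|T x| ≤ S |x|` for all `x`. -/
theorem abs_apply_le_of_operatorLE {T S : E →ₗ[ℝ] F} (h1 : OperatorLE T S)
    (h2 : OperatorLE (-T) S) (x : E) : |T x| ≤ S |x| := by
  have h : ∀ z : E, 0 ≤ z → |T z| ≤ S z := fun z hz => abs_le'.2 ⟨h1 z hz, h2 z hz⟩
  calc |T x| = |T x⁺ - T x⁻| := by rw [← map_sub, posPart_sub_negPart]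
    _ ≤ |T x⁺| + |T x⁻| := by
      rw [sub_eq_add_neg]
      exact (abs_add_le _ _).trans_eq (by rw [abs_neg])
    _ ≤ S x⁺ + S x⁻ := add_le_add (h _ (posPart_nonneg x)) (h _ (negPart_nonneg x))
    _ = S |x| := by rw [← map_add, posPart_add_negPart]

theorem IsPositiveOperator.mono {T : E →ₗ[ℝ] F} (hT : IsPositiveOperator T) {x y : E}
    (h : x ≤ y) : T x ≤ T y := by
  simpa using hT (y - x) (sub_nonneg.2 h)

/-- Positive operators between Banach lattices are continuous. -/
theorem IsPositiveOperator.continuous {T : E →ₗ[ℝ] F} (hT : IsPositiveOperator T) :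
    Continuous T := by
  obtain ⟨C, hC⟩ : ∃ C : ℝ, ∀ x, 0 ≤ x → ‖T x‖ ≤ C * ‖x‖ := by
    by_contra! H
    -- Otherwise there are `z n ≥ 0` with `‖z n‖ = 2 ^ (-n)` and `‖T (z n)‖ > 2 ^ n`; their sum
    -- dominates each of them.
    have hex : ∀ n : ℕ, ∃ z : E, 0 ≤ z ∧ ‖z‖ ≤ (1 / 2) ^ n ∧ 2 ^ n < ‖T z‖ := by
      intro n
      obtain ⟨x, hx, hxn⟩ := H (2 ^ n * 2 ^ n)
      have hx0 : 0 < ‖x‖ := norm_pos_iff.2 (by rintro rfl; simp at hxn)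
      have hpos : (0 : ℝ) < (2 ^ n * ‖x‖)⁻¹ := by positivity
      refine ⟨(2 ^ n * ‖x‖)⁻¹ • x, smul_nonneg hpos.le hx, ?_, ?_⟩
      · rw [norm_smul, Real.norm_of_nonneg hpos.le, mul_inv, mul_assoc,
          inv_mul_cancel₀ hx0.ne', mul_one, one_div, inv_pow]
      · rw [map_smul, norm_smul, Real.norm_of_nonneg hpos.le, lt_inv_mul_iff₀ (by positivity)]
        linarith
    choose z hz0 hz hTz using hex
    have hsum : Summable z := Summable.of_norm_bounded summable_geometric_two hz
    obtain ⟨n, hn⟩ := pow_unbounded_of_one_lt ‖T (∑' n, z n)‖ (one_lt_two (α := ℝ))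
    have h1 : T (z n) ≤ T (∑' n, z n) := hT.mono (hsum.le_tsum n fun i _ => hz0 i)
    exact absurd (norm_le_norm_of_nonneg_of_le (hT _ (hz0 n)) h1)
      (not_le.2 (hn.trans (hTz n)))
  refine AddMonoidHomClass.continuous_of_bound T C fun x => ?_
  have h1 : |T x| ≤ T |x| := abs_apply_le_of_operatorLE (fun _ _ => le_rfl)
    (fun z hz => (neg_nonpos.2 (hT z hz)).trans (hT z hz)) x
  calc ‖T x‖ ≤ ‖T |x|‖ := HasSolidNorm.solid (h1.trans (le_abs_self _))
    _ ≤ C * ‖|x|‖ := hC _ (abs_nonneg x)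
    _ = C * ‖x‖ := by rw [norm_abs_eq_norm]

/-- Domination: an operator `T` with `|T x| ≤ S |x|` factors through the completion of the domain
for the seminorm `x ↦ ‖S |x|‖`. If `S` is almost order-weakly compact, then this completion has
weakly compact order intervals. -/
theorem IsAOWeaklyCompact.of_dominated {T : E →L[ℝ] F} {S : E →ₗ[ℝ] F}
    (h1 : OperatorLE (T : E →ₗ[ℝ] F) S) (h2 : OperatorLE (-(T : E →ₗ[ℝ] F)) S)
    (hS : IsAOWeaklyCompact S) : IsAOWeaklyCompact (T : E →ₗ[ℝ] F) := by
  have hTS : ∀ x, |T x| ≤ S |x| := abs_apply_le_of_operatorLE h1 h2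
  have hSpos : IsPositiveOperator S := fun x hx => by
    have := hTS x
    rw [abs_of_nonneg hx] at this
    exact (abs_nonneg _).trans this
  have hq : ∀ x y : E, |x| ≤ |y| → ‖S |x|‖ ≤ ‖S |y|‖ := fun x y h =>
    norm_le_norm_of_nonneg_of_le (hSpos _ (abs_nonneg x)) (hSpos.mono h)
  have habs_smul : ∀ (r : ℝ) (x : E), |r • x| ≤ |r| • |x| := by
    have h : ∀ (r : ℝ), 0 ≤ r → ∀ x : E, |r • x| ≤ r • |x| := fun r hr x =>
      abs_le'.2 ⟨smul_le_smul_of_nonneg_left (le_abs_self x) hr, by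
        rw [← smul_neg]; exact smul_le_smul_of_nonneg_left (neg_le_abs x) hr⟩
    intro r x
    rcases le_total 0 r with hr | hr
    · rw [abs_of_nonneg hr]; exact h r hr x
    · rw [abs_of_nonpos hr, ← abs_neg, ← neg_smul]; exact h (-r) (neg_nonneg.2 hr) x
  let q : Seminorm ℝ E := Seminorm.ofSMulLE (fun x => ‖S |x|‖) (by simp)
    (fun x y => by
      refine le_trans (norm_le_norm_of_nonneg_of_le (hSpos _ (abs_nonneg _))
        (hSpos.mono (abs_add_le x y))) ?_
      rw [map_add]
      exact norm_add_le _ _)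
    (fun r x => by
      rw [Real.norm_eq_abs, ← abs_abs r, ← Real.norm_eq_abs |r|, ← norm_smul, ← map_smul]
      exact norm_le_norm_of_nonneg_of_le (hSpos _ (abs_nonneg _)) (hSpos.mono (habs_smul r x)))
  obtain ⟨G, _, _, _, _, j, hj, hjq, hsup⟩ := exists_banachLattice_of_seminorm q hq
  have hnorm : ∀ x, ‖j x‖ = ‖S |x|‖ := hjq
  have hG : BoundedSeriesNull G := by
    refine boundedSeriesNull_of_denseRange hj hsup fun v x hv hx hx0 hxv => ?_
    obtain ⟨s, hs⟩ := (hS.2 _ (almostOrderBounded_Icc v hv)).exists_tendsto_of_monotone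
      (x := fun n => S (x n)) (fun m n hmn => hSpos.mono (hx hmn))
      (fun n => ⟨x n, ⟨(neg_nonpos.2 hv).trans (hx0 n), hxv n⟩, rfl⟩)
    refine Metric.cauchySeq_iff'.2 fun ε hε => ?_
    obtain ⟨N, hN⟩ := Metric.cauchySeq_iff'.1 hs.cauchySeq ε hε
    refine ⟨N, fun n hn => ?_⟩
    have h := hN n hn
    rw [dist_eq_norm, ← map_sub] at h ⊢
    rwa [hnorm, abs_of_nonneg (sub_nonneg.2 (hx hn))]
  have hjmono : ∀ x y, x ≤ y → j x ≤ j y := fun x y h => by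
    rw [← sup_eq_right, ← hsup, sup_eq_right.2 h]
  let T' : G →L[ℝ] F := (T : E →ₗ[ℝ] F).extendOfNorm j
  have hT' : ∀ x, T' (j x) = T x := fun x => LinearMap.extendOfNorm_eq hj
    ⟨1, fun x => by
      rw [one_mul, hnorm]
      exact HasSolidNorm.solid ((hTS x).trans (le_abs_self _))⟩ x
  refine isAOWeaklyCompact_of_Icc T (fun w _ => isBounded_Icc_neg w) fun w hw => ?_
  have hjw : 0 ≤ j w := by simpa using hjmono 0 w hw
  refine ((relativelyWeaklyCompact_Icc hG.hasOrderContinuousNorm hG.dedekindComplete hjw).image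
    T').mono ?_
  rintro _ ⟨x, hx, rfl⟩
  exact ⟨j x, ⟨by simpa using hjmono _ _ hx.1, hjmono _ _ hx.2⟩, hT' x⟩

end Operators

/-! ### The dual positive Schur property -/

section DualSchur

variable {E : Type u} [NormedAddCommGroup E] [NormedSpace ℝ E] [Lattice E] [BanachLattice E]

attribute [local instance] dualLattice

/-- The terms of a bounded series of positive functionals are weak* null. -/
theorem DualPositiveSchur.boundedSeriesNull (hE : DualPositiveSchur E) :
    BoundedSeriesNull (StrongDual ℝ E) := by
  intro y f hy hf
  refine hE y hy ?_
  have hpos : ∀ x : E, 0 ≤ x → Tendsto (fun n => y n x) atTop (𝓝 0) := fun x hx =>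
    (summable_of_sum_range_le (c := f x) (fun n => hy n x hx) fun n => by
      simpa using hf n x hx).tendsto_atTop_zero
  refine tendsto_iff_forall_eval_tendsto_topDualPairing.2 fun x => ?_
  change Tendsto (fun n => y n x) atTop (𝓝 0)
  have h := (hpos _ (posPart_nonneg x)).sub (hpos _ (negPart_nonneg x))
  simpa only [← map_sub, posPart_sub_negPart, sub_zero] using h

/-- The adjoint of a positive operator maps order intervals of `F'` into order intervals of `E'`, and
the latter are relatively weakly compact. -/
theorem isAOWeaklyCompact_adjointOperator {F : Type v} [NormedAddCommGroup F] [NormedSpace ℝ F]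
    [Lattice F] [BanachLattice F] (hE : DualPositiveSchur E) {T : E →L[ℝ] F}
    (hT : IsPositiveOperator (T : E →ₗ[ℝ] F)) :
    IsAOWeaklyCompact (adjointOperator T : StrongDual ℝ F →ₗ[ℝ] StrongDual ℝ E) := by
  have := dualBanachLattice (E := E)
  have := dualBanachLattice (E := F)
  have hB := hE.boundedSeriesNull
  have hmono : ∀ g h : StrongDual ℝ F, g ≤ h → adjointOperator T g ≤ adjointOperator T h :=
    fun g h hgh x hx => hgh (T x) (hT x hx)
  refine isAOWeaklyCompact_of_Icc (adjointOperator T) (fun w _ => isBounded_Icc_neg w)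
    fun w hw => ?_
  have hw' : 0 ≤ adjointOperator T w := by simpa using hmono 0 w hw
  refine (relativelyWeaklyCompact_Icc hB.hasOrderContinuousNorm hB.dedekindComplete hw').mono ?_
  rintro _ ⟨g, hg, rfl⟩
  exact ⟨by simpa using hmono _ _ hg.1, hmono _ _ hg.2⟩

end DualSchur

/-! ### Characterizations of order continuity and compactness of operators -/

theorem mainTheorem2 :
    -- (1)
    (∀ (E : Type u) [NormedAddCommGroup E] [NormedSpace ℝ E] [Lattice E] [BanachLattice E],
      DedekindComplete E →
      (HasOrderContinuousNorm E ↔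
        ∀ (F : Type u) [NormedAddCommGroup F] [NormedSpace ℝ F] [Lattice F] [BanachLattice F]
          (T : E →ₗ[ℝ] F), IsPositiveOperator T → IsAOWeaklyCompact T)) ∧
    -- (2)
    (∀ (E : Type u) [NormedAddCommGroup E] [NormedSpace ℝ E] [Lattice E] [BanachLattice E],
      DedekindComplete E →
      (HasOrderContinuousNorm E ↔
        ∀ x : ℕ → E, DisjointSeq x → AlmostOrderBounded (Set.range x) →
          Tendsto (fun n => ‖x n‖) atTop (𝓝 0))) ∧
    -- (3)
    (∀ (E : Type u) [NormedAddCommGroup E] [NormedSpace ℝ E] [Lattice E] [BanachLattice E],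
      PropertyB E →
      (∀ T : E →L[ℝ] E, IsAOWeaklyCompact ((T ∘L T : E →L[ℝ] E) : E →ₗ[ℝ] E)) →
      HasOrderContinuousNorm E) ∧
    -- (4)
    (∀ (E : Type u) [NormedAddCommGroup E] [NormedSpace ℝ E] [Lattice E] [BanachLattice E]
      (F : Type v) [NormedAddCommGroup F] [NormedSpace ℝ F] [Lattice F] [BanachLattice F]
      (T : E →L[ℝ] F) (S : E →ₗ[ℝ] F),
      DedekindComplete F → IsModulus (T : E →ₗ[ℝ] F) S → IsAOWeaklyCompact S →
      IsAOWeaklyCompact (T : E →ₗ[ℝ] F)) ∧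
    -- (5) (a positive operator between Banach lattices is automatically continuous)
    (∀ (E : Type u) [NormedAddCommGroup E] [NormedSpace ℝ E] [Lattice E] [BanachLattice E]
      (F : Type v) [NormedAddCommGroup F] [NormedSpace ℝ F] [Lattice F] [BanachLattice F],
      DualPositiveSchur E → HasOrderContinuousNorm F → DedekindComplete F →
      ∀ T : E →L[ℝ] F, IsPositiveOperator (T : E →ₗ[ℝ] F) →
        IsAOWeaklyCompact (adjointOperator T : StrongDual ℝ F →ₗ[ℝ] StrongDual ℝ E)) := by
  refine ⟨?_, ?_, ?_, ?_, ?_⟩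
  · intro E _ _ _ _ hdc
    refine ⟨fun hE F _ _ _ _ T hT => ?_, fun h => ?_⟩
    · let T' : E →L[ℝ] F := ⟨T, hT.continuous⟩
      exact isAOWeaklyCompact_of_Icc T' (fun w _ => isBounded_Icc_neg w) fun w hw =>
        (relativelyWeaklyCompact_Icc hE hdc hw).image T'
    · have hid := h E LinearMap.id fun x hx => hx
      refine (boundedSeriesNull_of_relativelyWeaklyCompact_Icc fun w hw => ?_).hasOrderContinuousNorm
      simpa using hid.2 _ (almostOrderBounded_Icc w hw)
  · intro E _ _ _ _ hdc
    exact ⟨fun hE x hx hb => (hE.boundedSeriesNull hdc).tendsto_of_disjointSeq hx hb, fun h =>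
      (disjointSeqNull_of_almostOrderBounded h).boundedSeriesNull.hasOrderContinuousNorm⟩
  -- For the identity operator the hypothesis says that order intervals are relatively weakly
  -- compact.
  · intro E _ _ _ _ _ h
    have hid := h (ContinuousLinearMap.id ℝ E)
    refine (boundedSeriesNull_of_relativelyWeaklyCompact_Icc fun w hw => ?_).hasOrderContinuousNorm
    simpa using hid.2 _ (almostOrderBounded_Icc w hw)
  · intro E _ _ _ _ F _ _ _ _ T S _ hS hSc
    exact hSc.of_dominated hS.1 hS.2.1
  · intro E _ _ _ _ F _ _ _ _ hE _ _ T hT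
    exact isAOWeaklyCompact_adjointOperator hE hT
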